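/- All graphs are finite and simple. A \emph{trigraph} $G$ consists of a finite vertex set $V(G)$ and a function $\theta_G:\binom{V(G)}{2}\to\{-1,0,1\}$. Distinct vertices $u,v$ are \emph{strongly adjacent} if $\theta_G(uv)=1$, \emph{semi-adjacent} if $\theta_G(uv)=0$, \emph{strongly anti-adjacent} if $\theta_G(uv)=-1$, and \emph{adjacent} if $\theta_G(uv)\ge 0$. For $X\subseteq V(G)$, the \emph{induced subtrigraph} $G[X]$ has vertex set $X$ and the restricted function $\theta_G$. A \emph{realization} of $G$ is a graph on $V(G)$ in which all strongly adjacent pairs are edges and all strongly anti-adjacent pairs are non-edges (semi-adjacent pairs may be either); the \emph{full realization} is the one in which all semi-adjacent pairs are edges. A \emph{wheel} is a graph that consists of a chordless cycle together with one further vertex that has at least three neighbors in the cycle. A trigraph is \emph{$\{\mathrm{ISK4},\mathrm{wheel}\}$-free} if no realization of it contains a subdivision of $K_4$ or a wheel as an induced subgraph. A trigraph is \emph{series-parallel} if its full realization contains no subdivision of $K_4$ as a (not necessarily induced) subgraph. A \emph{strong $K_{3,3}$} is a trigraph with no semi-adjacent pairs whose full realization is isomorphic to $K_{3,3}$. A \emph{branch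 vertex} of a trigraph $K$ is a vertex adjacent to at least three vertices. For distinct branch vertices $a,b$ of $K$, an \emph{$(a,b)$-flat branch} of $K$ is an induced subtrigraph of $K$ whose full realization is a path with endpoints $a$ and $b$, none of whose interior vertices is a branch vertex of $K$, and none of whose adjacent pairs is contained in a set of three pairwise adjacent vertices of $K$. A \emph{strong triangle} is a set of three pairwise strongly adjacent vertices. A \emph{prism} is a trigraph $K$ that consists of two disjoint strong triangles $\{x_1,x_2,x_3\}$ and $\{y_1,y_2,y_3\}$ and, for each $i$, an $(x_i,y_i)$-flat branch $P_i$ of $K$, where $P_1,P_2,P_3$ are vertex-disjoint, $V(K)=V(P_1)\cup V(P_2)\cup V(P_3)$, and for $i\ne j$ the only adjacent pairs between $P_i$ and $P_j$ are $x_ix_j$ and $y_iy_j$. \textbf{Lemma.} Let $G$ be an $\{\mathrm{ISK4},\mathrm{wheel}\}$-free trigraph. Then either $G$ is series-parallel, or there is a set $X\subseteq V(G)$ such that $G[X]$ is a prism or a strong $K_{3,3}$. -/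

import Mathlib

namespace SimpleGraph

/-- `S` is (isomorphic to) a subdivision of `F`: the vertices of `F` are sent injectively to
branch vertices of `S`, every edge of `F` is replaced by a path of `S` joining the corresponding
branch vertices, two such paths meet only in common ends, no path runs through a further branch
vertex, and every vertex and every edge of `S` arises in this way. -/
def IsSubdivisionOf {W U : Type*} (S : SimpleGraph W) (F : SimpleGraph U) : Prop :=
  ∃ (f : U → W) (p : ∀ u v : U, F.Adj u v → S.Walk (f u) (f v)),
    Function.Injective f ∧
    (∀ u v (h : F.Adj u v), (p u v h).IsPath) ∧
    (∀ u v (h : F.Adj u v), p v u h.symm = (p u v h).reverse) ∧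
    (∀ u v (h : F.Adj u v) (a : U), f a ∈ (p u v h).support → a = u ∨ a = v) ∧
    (∀ u v (h : F.Adj u v) u' v' (h' : F.Adj u' v'), s(u, v) ≠ s(u', v') →
      ∀ w, w ∈ (p u v h).support → w ∈ (p u' v' h').support → ∃ a, w = f a) ∧
    (∀ w, (∃ a, w = f a) ∨ ∃ u v, ∃ h : F.Adj u v, w ∈ (p u v h).support) ∧
    (∀ e ∈ S.edgeSet, ∃ u v, ∃ h : F.Adj u v, e ∈ (p u v h).edges)

/-- No induced subgraph is a subdivision of `K₄`. -/
def IsISK4Free {V : Type*} (G : SimpleGraph V) : Prop :=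
  ∀ X : Set V, ¬ (G.induce X).IsSubdivisionOf (completeGraph (Fin 4))

/-- A wheel: a chordless cycle (of length at least three), together with one further vertex `c`
that has at least three neighbors in the cycle. -/
def IsWheel {V : Type*} (W : SimpleGraph V) : Prop :=
  ∃ (c a : V) (C : W.Walk a a), C.IsCycle ∧ C.IsChordless ∧
    (∀ v, v ∈ C.support ↔ v ≠ c) ∧ 3 ≤ {v | v ∈ C.support ∧ W.Adj c v}.ncard

/-- No induced subgraph is a wheel. -/
def IsWheelFree {V : Type*} (G : SimpleGraph V) : Prop :=
  ∀ X : Set V, ¬ (G.induce X).IsWheel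

/-- No subgraph, induced or not, is a subdivision of `K₄`. -/
def IsSeriesParallel {V : Type*} (G : SimpleGraph V) : Prop :=
  ∀ S : G.Subgraph, ¬ S.coe.IsSubdivisionOf (completeGraph (Fin 4))

end SimpleGraph

/-- A trigraph on `V`: a function from the unordered pairs of distinct vertices to `{-1, 0, 1}`,
written as a symmetric function of two vertices that is given the value `-1` on the diagonal. -/
@[ext]
structure Trigraph (V : Type*) where
  θ : V → V → SignType
  symm : ∀ u v, θ u v = θ v u
  diag : ∀ v, θ v v = -1

namespace Trigraph

variable {V : Type*}

/-- Adjacent: strongly adjacent or semi-adjacent. -/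
def Adj (G : Trigraph V) (u v : V) : Prop := 0 ≤ G.θ u v

def StrongAdj (G : Trigraph V) (u v : V) : Prop := G.θ u v = 1

def SemiAdj (G : Trigraph V) (u v : V) : Prop := G.θ u v = 0

def StrongAntiAdj (G : Trigraph V) (u v : V) : Prop := u ≠ v ∧ G.θ u v = -1

/-- The subtrigraph induced by `X`. -/
def induce (G : Trigraph V) (X : Set V) : Trigraph X where
  θ u v := G.θ u v
  symm u v := G.symm u v
  diag v := G.diag v

/-- `H` arises from `G` by deciding each semi-adjacent pair to be an edge or a non-edge. -/
def IsRealization (G : Trigraph V) (H : SimpleGraph V) : Prop :=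
  ∀ u v, (G.StrongAdj u v → H.Adj u v) ∧ (G.StrongAntiAdj u v → ¬ H.Adj u v)

/-- The realization in which every semi-adjacent pair becomes an edge. -/
def fullRealization (G : Trigraph V) : SimpleGraph V where
  Adj u v := G.Adj u v
  symm := ⟨fun u v h => by
    unfold Adj at *
    rwa [G.symm v u]⟩
  loopless := ⟨fun v h => by
    unfold Adj at h
    rw [G.diag v] at h
    exact absurd h (by decide)⟩

/-- All realizations are ISK4-free. -/
def IsISK4Free (G : Trigraph V) : Prop :=
  ∀ H : SimpleGraph V, G.IsRealization H → H.IsISK4Free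

/-- All realizations are wheel-free. -/
def IsWheelFree (G : Trigraph V) : Prop :=
  ∀ H : SimpleGraph V, G.IsRealization H → H.IsWheelFree

def IsSeriesParallel (G : Trigraph V) : Prop :=
  G.fullRealization.IsSeriesParallel

/-- `G[P]` is a narrow path between `a` and `b`: its full realization is a path with ends `a` and
`b`, that is, `P` is the vertex set of an induced path of the full realization of `G`. -/
def IsNarrowPath (G : Trigraph V) (a b : V) (P : Set V) : Prop :=
  ∃ p : G.fullRealization.Walk a b, p.IsPath ∧ p.IsChordless ∧ {v | v ∈ p.support} = P

/-- The number of neighbors of `v`. -/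
noncomputable def degree (G : Trigraph V) (v : V) : ℕ := {u | G.Adj v u}.ncard

def IsBranchVertex (G : Trigraph V) (v : V) : Prop := 3 ≤ G.degree v

/-- `G[P]` is an `(a, b)`-branch of `G`. -/
def IsBranch (G : Trigraph V) (a b : V) (P : Set V) : Prop :=
  G.IsNarrowPath a b P ∧ a ≠ b ∧ G.IsBranchVertex a ∧ G.IsBranchVertex b ∧
    ∀ v ∈ P, v ≠ a → v ≠ b → ¬ G.IsBranchVertex v

/-- A branch none of whose adjacent pairs lies in a triangle of `G`. -/
def IsFlatBranch (G : Trigraph V) (a b : V) (P : Set V) : Prop :=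
  G.IsBranch a b P ∧ ∀ u ∈ P, ∀ v ∈ P, G.Adj u v → ∀ w, ¬ (G.Adj u w ∧ G.Adj v w)

/-- A prism: two vertex-disjoint strong triangles `{x 0, x 1, x 2}` and `{y 0, y 1, y 2}`, joined
by an `(x i, y i)`-flat branch `P i` for each `i`, such that for `i ≠ j` the pairs `x i, x j` and
`y i, y j` are the only adjacent pairs between `P i` and `P j`, and with no other vertices. -/
def IsPrism (K : Trigraph V) : Prop :=
  ∃ (x y : Fin 3 → V) (P : Fin 3 → Set V),
    (∀ i j, i ≠ j → K.StrongAdj (x i) (x j)) ∧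
    (∀ i j, i ≠ j → K.StrongAdj (y i) (y j)) ∧
    (∀ i j, x i ≠ y j) ∧
    (∀ i, K.IsFlatBranch (x i) (y i) (P i)) ∧
    (∀ i j, i ≠ j → Disjoint (P i) (P j)) ∧
    (∀ i j, i ≠ j → ∀ u ∈ P i, ∀ v ∈ P j, K.Adj u v →
      (u = x i ∧ v = x j) ∨ (u = y i ∧ v = y j)) ∧
    ∀ v, ∃ i, v ∈ P i

/-- The full realization is a `K₃,₃` and there is no semi-adjacent pair. -/
def IsStrongK33 (K : Trigraph V) : Prop :=
  Nonempty (K.fullRealization ≃g completeBipartiteGraph (Fin 3) (Fin 3)) ∧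
    ∀ u v, ¬ K.SemiAdj u v

end Trigraph

/-! Suppose that the full realization is not series-parallel. Then it has a `K₄` minor: four
disjoint connected vertex sets ("bags"), pairwise joined by edges. Fix a minimal vertex set `X` that
contains such a minor. As `K₄` has maximum degree three, `X` contains a subdivision `H` of `K₄`
(`HasK4Minor.exists_k4Sub`), and by minimality `H` covers `X` and is tight: no `K₄` minor survives
the loss of a vertex. Minimality is imposed on minors rather than on subdivisions because it is then
refuted by merely exhibiting four bags that miss a vertex.

It remains to study the edges of the full realization on `X` that do not lie on `H`. Tightness
excludes chords of a single branch path. A branch vertex with a neighbor inside a path that does not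
end there yields a wheel (`K4Sub.Tight.exists_isWheel`). An edge between the interiors of two paths
with a common end forces a prism (`K4Sub.Tight.prismOn`), and one between the interiors of two
opposite paths forces a `K₃,₃` (`K4Sub.Tight.k33On`). If there are no such edges, then `H` is an
induced subdivision of `K₄`. Hence `X` induces a prism or a `K₃,₃` (`prismOn_or_k33On`).

Finally, the triangles of the prism and all edges of the `K₃,₃` are strong. If such an edge came
from a semi-adjacent pair, deleting it would give another realization. It still has a `K₄` minor on
`X`, and `X` is still minimal, since fewer edges give fewer minors. So `X` would again induce one of
the two shapes. But both shapes have exactly six vertices of degree three and none of larger degree,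
and deleting an edge at such a vertex lowers their number (`not_shape_deleteEdges`). -/

namespace SimpleGraph

variable {V : Type*}

/-! ### Segments of vertex sequences. -/

/-- The image of the interval `[s, t]` under a sequence of vertices. -/
def seg (f : ℕ → V) (s t : ℕ) : Set V := f '' Set.Icc s t

theorem mem_seg {f : ℕ → V} {s t : ℕ} {v : V} : v ∈ seg f s t ↔ ∃ r, (s ≤ r ∧ r ≤ t) ∧ f r = v :=
  Iff.rfl

theorem apply_mem_seg {f : ℕ → V} {s t r : ℕ} (h₁ : s ≤ r) (h₂ : r ≤ t) : f r ∈ seg f s t :=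
  ⟨r, ⟨h₁, h₂⟩, rfl⟩

theorem connected_induce_singleton (G : SimpleGraph V) (v : V) :
    (G.induce {v}).Connected := by
  rw [connected_iff]
  exact ⟨fun a b => by rw [Subsingleton.elim a b], ⟨⟨v, rfl⟩⟩⟩

theorem seg_connected {G : SimpleGraph V} {f : ℕ → V} {s t : ℕ} (hst : s ≤ t)
    (h : ∀ r, s ≤ r → r < t → G.Adj (f r) (f (r + 1))) : (G.induce (seg f s t)).Connected := by
  induction t, hst using Nat.le_induction with
  | base =>
    have : seg f s s = {f s} := by simp [seg]
    rw [this]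
    exact connected_induce_singleton _ _
  | succ t hst ih =>
    have : seg f s (t + 1) = seg f s t ∪ seg f (t + 1) (t + 1) := by
      ext v
      simp only [Set.mem_union, mem_seg]
      constructor
      · rintro ⟨r, hr, rfl⟩
        by_cases h : r ≤ t
        · exact Or.inl ⟨r, ⟨hr.1, h⟩, rfl⟩
        · exact Or.inr ⟨r, ⟨by omega, hr.2⟩, rfl⟩
      · rintro (⟨r, hr, rfl⟩ | ⟨r, hr, rfl⟩) <;> exact ⟨r, ⟨by omega, by omega⟩, rfl⟩
    rw [this]
    have h2 : seg f (t + 1) (t + 1) = {f (t + 1)} := by simp [seg]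
    refine connected_induce_union (ih fun r h₁ h₂ => h r h₁ (by omega)).preconnected ?_
      (apply_mem_seg hst le_rfl) (apply_mem_seg le_rfl le_rfl) (h t hst (by omega))
    rw [h2]
    exact (connected_induce_singleton _ _).preconnected

/-! ### Minors of `K₄` given by bags. -/

/-- Four disjoint connected subsets of `X`, pairwise joined by edges. -/
def HasK4Minor (G : SimpleGraph V) (X : Set V) : Prop :=
  ∃ A : Fin 4 → Set V, (∀ i, A i ⊆ X) ∧ (∀ i, (G.induce (A i)).Connected) ∧
    (∀ i j, i ≠ j → Disjoint (A i) (A j)) ∧ ∀ i j, i ≠ j → ∃ u ∈ A i, ∃ v ∈ A j, G.Adj u v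

theorem HasK4Minor.mono {G : SimpleGraph V} {X Y : Set V} (h : G.HasK4Minor X) (hXY : X ⊆ Y) :
    G.HasK4Minor Y := by
  obtain ⟨A, h₁, h₂⟩ := h
  exact ⟨A, fun i => (h₁ i).trans hXY, h₂⟩

theorem HasK4Minor.mono_graph {G G' : SimpleGraph V} (hG : G ≤ G') {X : Set V}
    (h : G.HasK4Minor X) : G'.HasK4Minor X := by
  obtain ⟨A, h₁, h₂, h₃, h₄⟩ := h
  refine ⟨A, h₁, fun i => (h₂ i).mono (by intro u v h; exact hG h), h₃, fun i j hij => ?_⟩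
  obtain ⟨u, hu, v, hv, h⟩ := h₄ i j hij
  exact ⟨u, hu, v, hv, hG h⟩

/-- Two sets of vertices joined by an edge. -/
def Touch (G : SimpleGraph V) (A B : Set V) : Prop := ∃ u ∈ A, ∃ v ∈ B, G.Adj u v

theorem Touch.symm {G : SimpleGraph V} {A B : Set V} (h : G.Touch A B) : G.Touch B A := by
  obtain ⟨u, hu, v, hv, h⟩ := h
  exact ⟨v, hv, u, hu, h.symm⟩

theorem HasK4Minor.of_sets {G : SimpleGraph V} {X A B C D : Set V}
    (hA : A ⊆ X) (hB : B ⊆ X) (hC : C ⊆ X) (hD : D ⊆ X)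
    (cA : (G.induce A).Connected) (cB : (G.induce B).Connected)
    (cC : (G.induce C).Connected) (cD : (G.induce D).Connected)
    (dAB : Disjoint A B) (dAC : Disjoint A C) (dAD : Disjoint A D)
    (dBC : Disjoint B C) (dBD : Disjoint B D) (dCD : Disjoint C D)
    (tAB : G.Touch A B) (tAC : G.Touch A C) (tAD : G.Touch A D)
    (tBC : G.Touch B C) (tBD : G.Touch B D) (tCD : G.Touch C D) : G.HasK4Minor X := by
  refine ⟨![A, B, C, D], ?_, ?_, ?_, ?_⟩
  · intro i; fin_cases i <;> assumption
  · intro i; fin_cases i <;> assumption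
  · intro i j hij
    fin_cases i <;> fin_cases j <;> first
      | exact absurd rfl hij | assumption | (apply Disjoint.symm; assumption)
  · intro i j hij
    fin_cases i <;> fin_cases j <;> first
      | exact absurd rfl hij | assumption | (apply Touch.symm; assumption)

/-! ### Parametrised subdivisions of `K₄`. -/

/-- A subdivision of `K₄` in `G`, with its branches parametrised as sequences of vertices. -/
structure K4Sub (G : SimpleGraph V) where
  b : Fin 4 → V
  n : Fin 4 → Fin 4 → ℕ
  p : Fin 4 → Fin 4 → ℕ → V
  n_symm : ∀ i j, n i j = n j i
  n_pos : ∀ i j, i ≠ j → 0 < n i j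
  p_zero : ∀ i j, i ≠ j → p i j 0 = b i
  p_symm : ∀ i j s, i ≠ j → s ≤ n i j → p j i s = p i j (n i j - s)
  adj : ∀ i j s, i ≠ j → s < n i j → G.Adj (p i j s) (p i j (s + 1))
  b_inj : Function.Injective b
  p_ne_b : ∀ i j s k, i ≠ j → 0 < s → s < n i j → p i j s ≠ b k
  p_inj : ∀ i j s i' j' t, i ≠ j → i' ≠ j' → 0 < s → s < n i j → 0 < t → t < n i' j' →
    p i j s = p i' j' t → (i = i' ∧ j = j' ∧ s = t) ∨ (i = j' ∧ j = i' ∧ s + t = n i j)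

namespace K4Sub

variable {G : SimpleGraph V} (H : K4Sub G)

/-- Only the indices `s ≤ H.n i j` with `i ≠ j` carry meaning; all other values of `H.p` are
arbitrary. Each branch path occurs twice, once in each direction. -/
def verts : Set V := {v | ∃ i j s, i ≠ j ∧ s ≤ H.n i j ∧ H.p i j s = v}

theorem p_n {i j : Fin 4} (hij : i ≠ j) : H.p i j (H.n i j) = H.b j := by
  have := H.p_symm i j 0 hij (Nat.zero_le _)
  rw [H.p_zero j i hij.symm] at this
  simpa using this.symm

theorem p_inj_same {i j : Fin 4} (hij : i ≠ j) {s t : ℕ} (hs : s ≤ H.n i j) (ht : t ≤ H.n i j)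
    (h : H.p i j s = H.p i j t) : s = t := by
  have h0 := H.p_zero i j hij
  have hn := H.p_n hij
  have key : ∀ s t, s ≤ H.n i j → t ≤ H.n i j → s < t → H.p i j s ≠ H.p i j t := by
    intro s t hs ht hst h
    rcases Nat.eq_zero_or_pos s with rfl | hs0
    · rcases ht.eq_or_lt with rfl | ht'
      · rw [h0, hn] at h
        exact hij (H.b_inj h)
      · exact H.p_ne_b i j t i hij hst ht' (by rw [← h, h0])
    · rcases ht.eq_or_lt with rfl | ht'
      · exact H.p_ne_b i j s j hij hs0 hst (by rw [h, hn])
      · rcases H.p_inj i j s i j t hij hij hs0 (by omega) (by omega) ht' h with h | h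
        · omega
        · exact hij h.1
  rcases lt_trichotomy s t with h' | h' | h'
  · exact absurd h (key _ _ hs ht h')
  · exact h'
  · exact absurd h.symm (key _ _ ht hs h')

theorem disjoint_seg_same {i j : Fin 4} (hij : i ≠ j) {s t s' t' : ℕ} (ht : t ≤ H.n i j)
    (ht' : t' ≤ H.n i j) (h : t < s' ∨ t' < s) :
    Disjoint (seg (H.p i j) s t) (seg (H.p i j) s' t') := by
  rw [Set.disjoint_left]
  rintro _ ⟨r, hr, rfl⟩ ⟨r', hr', e⟩
  have := hr.1; have := hr.2; have := hr'.1; have := hr'.2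
  have := H.p_inj_same hij (by omega) (by omega) e
  omega

/-- Two different branch paths share at most ends. Each of `h₁` to `h₄` treats one possible
coincidence of ends and asks that one of the two segments stop short of it. -/
theorem disjoint_seg {i j i' j' : Fin 4} (hij : i ≠ j) (hij' : i' ≠ j')
    (hne : ¬ (i = i' ∧ j = j')) (hne' : ¬ (i = j' ∧ j = i')) {s t s' t' : ℕ}
    (ht : t ≤ H.n i j) (ht' : t' ≤ H.n i' j')
    (h₁ : i = i' → 0 < s ∨ 0 < s') (h₂ : i = j' → 0 < s ∨ t' < H.n i' j')
    (h₃ : j = i' → t < H.n i j ∨ 0 < s') (h₄ : j = j' → t < H.n i j ∨ t' < H.n i' j') :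
    Disjoint (seg (H.p i j) s t) (seg (H.p i' j') s' t') := by
  rw [Set.disjoint_left]
  rintro _ ⟨r, hr, rfl⟩ ⟨r', hr', e⟩
  have := hr.1; have := hr.2; have := hr'.1; have := hr'.2
  have h0 := H.p_zero i j hij
  have hn := H.p_n hij
  have h0' := H.p_zero i' j' hij'
  have hn' := H.p_n hij'
  by_cases hr0 : r = 0
  · subst hr0
    rw [h0] at e
    by_cases hr0' : r' = 0
    · subst hr0'
      rw [h0'] at e
      have := h₁ (H.b_inj e).symm
      omega
    by_cases hrn' : r' = H.n i' j'
    · subst hrn'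
      rw [hn'] at e
      have := h₂ (H.b_inj e).symm
      omega
    exact H.p_ne_b _ _ _ _ hij' (by omega) (by omega) e
  by_cases hrn : r = H.n i j
  · subst hrn
    rw [hn] at e
    by_cases hr0' : r' = 0
    · subst hr0'
      rw [h0'] at e
      have := h₃ (H.b_inj e).symm
      omega
    by_cases hrn' : r' = H.n i' j'
    · subst hrn'
      rw [hn'] at e
      have := h₄ (H.b_inj e).symm
      omega
    exact H.p_ne_b _ _ _ _ hij' (by omega) (by omega) e
  by_cases hr0' : r' = 0
  · subst hr0'
    rw [h0'] at e
    exact H.p_ne_b _ _ _ _ hij (by omega) (by omega) e.symm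
  by_cases hrn' : r' = H.n i' j'
  · subst hrn'
    rw [hn'] at e
    exact H.p_ne_b _ _ _ _ hij (by omega) (by omega) e.symm
  rcases H.p_inj _ _ _ _ _ _ hij hij' (by omega) (by omega) (by omega) (by omega) e.symm with h | h
  · exact hne ⟨h.1, h.2.1⟩
  · exact hne' ⟨h.1, h.2.1⟩

theorem seg_connected {i j : Fin 4} (hij : i ≠ j) {s t : ℕ} (hst : s ≤ t) (ht : t ≤ H.n i j) :
    (G.induce (seg (H.p i j) s t)).Connected :=
  SimpleGraph.seg_connected hst fun r _ h => H.adj i j r hij (by omega)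

theorem seg_subset {i j : Fin 4} (hij : i ≠ j) {s t : ℕ} (ht : t ≤ H.n i j) :
    seg (H.p i j) s t ⊆ H.verts := by
  rintro _ ⟨r, hr, rfl⟩
  exact ⟨i, j, r, hij, hr.2.trans ht, rfl⟩

theorem b_mem_seg_left {i j : Fin 4} (hij : i ≠ j) {t : ℕ} : H.b i ∈ seg (H.p i j) 0 t := by
  rw [← H.p_zero i j hij]
  exact apply_mem_seg le_rfl (Nat.zero_le _)

theorem b_mem_seg_right {i j : Fin 4} (hij : i ≠ j) {s : ℕ} (hs : s ≤ H.n i j) :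
    H.b j ∈ seg (H.p i j) s (H.n i j) := by
  rw [← H.p_n hij]
  exact apply_mem_seg hs le_rfl

theorem adj_b {i j : Fin 4} (hij : i ≠ j) : G.Adj (H.p i j (H.n i j - 1)) (H.b j) := by
  have := H.n_pos i j hij
  have h := H.adj i j (H.n i j - 1) hij (by omega)
  rwa [Nat.sub_add_cancel (by omega), H.p_n hij] at h

theorem adj_b_left {i j : Fin 4} (hij : i ≠ j) : G.Adj (H.b i) (H.p i j 1) := by
  have := H.n_pos i j hij
  have h := H.adj i j 0 hij (by omega)
  rwa [H.p_zero i j hij] at h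

/-- No vertex can be deleted without losing all `K₄` minors. -/
def Tight : Prop := ∀ i j s, i ≠ j → s ≤ H.n i j → ∀ Y : Set V, Y ⊆ H.verts →
  Disjoint Y (seg (H.p i j) s s) → ¬ G.HasK4Minor Y

end K4Sub

/-! ### Chords of a tight subdivision. -/

namespace K4Sub

variable {G : SimpleGraph V} {H : K4Sub G}

theorem connected_union {A B : Set V} (hA : (G.induce A).Connected)
    (hB : (G.induce B).Connected) (x : V) (hxA : x ∈ A) (hxB : x ∈ B) :
    (G.induce (A ∪ B)).Connected :=
  induce_union_connected hA.preconnected hB.preconnected ⟨x, hxA, hxB⟩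

/-- The usual contact between bags: one contains a branch path up to the vertex before its end, the
other contains that end. -/
theorem touch_b (H : K4Sub G) {i j : Fin 4} (hij : i ≠ j) {A B : Set V}
    (hA : H.p i j (H.n i j - 1) ∈ A) (hB : H.b j ∈ B) : G.Touch A B :=
  ⟨_, hA, _, hB, H.adj_b hij⟩

theorem last_mem_seg (H : K4Sub G) {i j : Fin 4} {s : ℕ} (hs : s ≤ H.n i j - 1) :
    H.p i j (H.n i j - 1) ∈ seg (H.p i j) s (H.n i j - 1) :=
  apply_mem_seg hs le_rfl

theorem exists_hasK4Minor_of_sets (H : K4Sub G) (A B C D Z : Set V)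
    (sub : A ⊆ H.verts ∧ B ⊆ H.verts ∧ C ⊆ H.verts ∧ D ⊆ H.verts)
    (conn : (G.induce A).Connected ∧ (G.induce B).Connected ∧
      (G.induce C).Connected ∧ (G.induce D).Connected)
    (disj : (Disjoint A B ∧ Disjoint A C ∧ Disjoint A D ∧ Disjoint B C ∧ Disjoint B D ∧
      Disjoint C D) ∧ Disjoint A Z ∧ Disjoint B Z ∧ Disjoint C Z ∧ Disjoint D Z)
    (touch : G.Touch A B ∧ G.Touch A C ∧ G.Touch A D ∧ G.Touch B C ∧ G.Touch B D ∧
      G.Touch C D) : ∃ Y ⊆ H.verts, Disjoint Y Z ∧ G.HasK4Minor Y := by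
  obtain ⟨d, dA, dB, dC, dD⟩ := disj
  refine ⟨A ∪ B ∪ C ∪ D, ?_, ?_, HasK4Minor.of_sets (A := A) (B := B) (C := C)
    (D := D) ?_ ?_ ?_ ?_ conn.1 conn.2.1 conn.2.2.1 conn.2.2.2 d.1 d.2.1 d.2.2.1 d.2.2.2.1
    d.2.2.2.2.1 d.2.2.2.2.2 touch.1 touch.2.1 touch.2.2.1 touch.2.2.2.1 touch.2.2.2.2.1
    touch.2.2.2.2.2⟩
  · simp only [Set.union_subset_iff]
    tauto
  · simp only [Set.disjoint_union_left]
    tauto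
  all_goals intro x hx; simp only [Set.mem_union]; tauto

/-- The common format of the chord lemmas below: four bags that miss the single vertex `H.p i j s`
contradict tightness. Each of those lemmas only has to find the bags that the chord makes possible.
-/
theorem Tight.false_of_sets (hH : H.Tight) {i j : Fin 4} {s : ℕ} (hij : i ≠ j) (hs : s ≤ H.n i j)
    (A B C D : Set V)
    (sub : A ⊆ H.verts ∧ B ⊆ H.verts ∧ C ⊆ H.verts ∧ D ⊆ H.verts)
    (conn : (G.induce A).Connected ∧ (G.induce B).Connected ∧
      (G.induce C).Connected ∧ (G.induce D).Connected)
    (disj : (Disjoint A B ∧ Disjoint A C ∧ Disjoint A D ∧ Disjoint B C ∧ Disjoint B D ∧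
      Disjoint C D) ∧ Disjoint A (seg (H.p i j) s s) ∧ Disjoint B (seg (H.p i j) s s) ∧
      Disjoint C (seg (H.p i j) s s) ∧ Disjoint D (seg (H.p i j) s s))
    (touch : G.Touch A B ∧ G.Touch A C ∧ G.Touch A D ∧ G.Touch B C ∧ G.Touch B D ∧
      G.Touch C D) : False := by
  obtain ⟨Y, hY, hd, hm⟩ := H.exists_hasK4Minor_of_sets A B C D _ sub conn disj touch
  exact hH i j s hij hs Y hY hd hm

/-- The shortcut stands in for the piece of the path strictly between its ends. The bags are the two
remaining pieces of the path, and stars around `c` and `d`. For `t = s + 1` the omitted segment is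
empty, which gives the plain minor of a subdivision. -/
theorem exists_hasK4Minor_of_shortcut (H : K4Sub G) {a b c d : Fin 4} (hab : a ≠ b) (hac : a ≠ c)
    (had : a ≠ d) (hbc : b ≠ c) (hbd : b ≠ d) (hcd : c ≠ d)
    {s t : ℕ} (hst : s < t) (ht : t ≤ H.n a b) (h : G.Adj (H.p a b s) (H.p a b t)) :
    ∃ Y ⊆ H.verts, Disjoint Y (seg (H.p a b) (s + 1) (t - 1)) ∧ G.HasK4Minor Y := by
  have n0 := H.n_pos _ _ hab
  have n1 := H.n_pos _ _ hac.symm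
  have n2 := H.n_pos _ _ hbc.symm
  have n3 := H.n_pos _ _ had.symm
  have n4 := H.n_pos _ _ hbd.symm
  have n5 := H.n_pos _ _ hcd.symm
  refine H.exists_hasK4Minor_of_sets
    (seg (H.p a b) 0 s)
    (seg (H.p a b) t (H.n a b))
    (seg (H.p c a) 0 (H.n c a - 1) ∪ seg (H.p c b) 0 (H.n c b - 1))
    (seg (H.p d a) 0 (H.n d a - 1) ∪ seg (H.p d b) 0 (H.n d b - 1) ∪ seg (H.p d c) 0 (H.n d c - 1))
      (seg (H.p a b) (s + 1) (t - 1)) ?_ ?_ ?_ ?_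
  · simp only [Set.union_subset_iff]
    repeat' apply And.intro
    all_goals apply H.seg_subset <;> omega
  · refine ⟨?_, ?_, ?_, ?_⟩
    · exact H.seg_connected hab (by omega) (by omega)
    · exact H.seg_connected hab (by omega) (by omega)
    · exact connected_union (H.seg_connected hac.symm (by omega) (by omega))
        (H.seg_connected hbc.symm (by omega) (by omega))
        (H.b c) (H.b_mem_seg_left hac.symm) (H.b_mem_seg_left hbc.symm)
    · exact connected_union (connected_union (H.seg_connected had.symm (by omega) (by omega))
        (H.seg_connected hbd.symm (by omega) (by omega))
        (H.b d) (H.b_mem_seg_left had.symm) (H.b_mem_seg_left hbd.symm))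
        (H.seg_connected hcd.symm (by omega) (by omega))
        (H.b d) (Or.inl (H.b_mem_seg_left had.symm)) (H.b_mem_seg_left hcd.symm)
  · simp only [Set.disjoint_union_left, Set.disjoint_union_right]
    repeat' apply And.intro
    all_goals first
      | (apply H.disjoint_seg_same <;> omega)
      | (apply H.disjoint_seg <;> grind)
  · refine ⟨?_, ?_, ?_, ?_, ?_, ?_⟩
    · exact ⟨_, apply_mem_seg (by omega) (by omega), _, apply_mem_seg (by omega) (by omega), h⟩
    · exact (H.touch_b hac.symm (Or.inl (H.last_mem_seg (by omega))) (H.b_mem_seg_left hab)).symm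
    · exact (H.touch_b had.symm (Or.inl (Or.inl (H.last_mem_seg (by omega))))
        (H.b_mem_seg_left hab)).symm
    · exact (H.touch_b hbc.symm (Or.inr (H.last_mem_seg (by omega)))
        (H.b_mem_seg_right hab (by omega))).symm
    · exact (H.touch_b hbd.symm (Or.inl (Or.inr (H.last_mem_seg (by omega))))
        (H.b_mem_seg_right hab (by omega))).symm
    · exact (H.touch_b hcd.symm (Or.inr (H.last_mem_seg (by omega)))
        (Or.inl (H.b_mem_seg_left hac.symm))).symm

theorem hasK4Minor_verts (H : K4Sub G) : G.HasK4Minor H.verts := by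
  have h01 : (0 : Fin 4) ≠ 1 := by decide
  have := H.n_pos 0 1 h01
  obtain ⟨Y, hY, -, hm⟩ := H.exists_hasK4Minor_of_shortcut (a := 0) (b := 1) (c := 2) (d := 3)
    h01 (by decide) (by decide) (by decide) (by decide) (by decide) (s := 0) (t := 1)
    (by omega) (by omega) (H.adj 0 1 0 h01 this)
  exact hm.mono hY

theorem Tight.no_chord (hH : H.Tight) {a b c d : Fin 4} (hab : a ≠ b) (hac : a ≠ c)
    (had : a ≠ d) (hbc : b ≠ c) (hbd : b ≠ d) (hcd : c ≠ d)
    {s t : ℕ} (hst : s < t) (ht : t ≤ H.n a b) (h : G.Adj (H.p a b s) (H.p a b t)) :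
    t = s + 1 := by
  by_contra hne
  obtain ⟨Y, hY, hd, hm⟩ := H.exists_hasK4Minor_of_shortcut hab hac had hbc hbd hcd hst ht h
  refine hH a b (s + 1) hab (by omega) Y hY (hd.mono_right ?_) hm
  rintro _ ⟨r, hr, rfl⟩
  exact apply_mem_seg hr.1 (hr.2.trans (by omega))

/-- A chord from `ab` to the interior of `ac` starts next to `a`. -/
theorem Tight.eq_one_of_adj_adjacent (hH : H.Tight) {a b c d : Fin 4} (hab : a ≠ b) (hac : a ≠ c)
    (had : a ≠ d) (hbc : b ≠ c) (hbd : b ≠ d) (hcd : c ≠ d)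
    {s t : ℕ} (hs : 1 ≤ s) (hsn : s ≤ H.n a b) (ht : 1 ≤ t) (htn : t < H.n a c)
    (h : G.Adj (H.p a b s) (H.p a c t)) : s = 1 := by
  have n0 := H.n_pos _ _ hab
  have n1 := H.n_pos _ _ hac
  have n2 := H.n_pos _ _ had
  have n3 := H.n_pos _ _ hbc.symm
  have n4 := H.n_pos _ _ hbd.symm
  have n5 := H.n_pos _ _ hcd.symm
  by_contra hlen
  -- If `s ≥ 2`, the chord replaces the start of `ab`, so that vertex 1 of that path is superfluous.
  refine hH.false_of_sets (s := 1) hab (by omega)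
    (seg (H.p a c) 0 (H.n a c - 1) ∪ seg (H.p a d) 0 (H.n a d - 1))
    (seg (H.p a b) s (H.n a b))
    (seg (H.p c b) 0 (H.n c b - 1))
    (seg (H.p d b) 0 (H.n d b - 1) ∪ seg (H.p d c) 0 (H.n d c - 1)) ?_ ?_ ?_ ?_
  · simp only [Set.union_subset_iff]
    repeat' apply And.intro
    all_goals apply H.seg_subset <;> omega
  · refine ⟨?_, ?_, ?_, ?_⟩
    · exact connected_union (H.seg_connected hac (by omega) (by omega))
        (H.seg_connected had (by omega) (by omega))
        (H.b a) (H.b_mem_seg_left hac) (H.b_mem_seg_left had)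
    · exact H.seg_connected hab (by omega) (by omega)
    · exact H.seg_connected hbc.symm (by omega) (by omega)
    · exact connected_union (H.seg_connected hbd.symm (by omega) (by omega))
        (H.seg_connected hcd.symm (by omega) (by omega))
        (H.b d) (H.b_mem_seg_left hbd.symm) (H.b_mem_seg_left hcd.symm)
  · simp only [Set.disjoint_union_left, Set.disjoint_union_right]
    repeat' apply And.intro
    all_goals first
      | (apply H.disjoint_seg_same <;> omega)
      | (apply H.disjoint_seg <;> grind)
  · refine ⟨?_, ?_, ?_, ?_, ?_, ?_⟩
    · exact ⟨_, Or.inl (apply_mem_seg (by omega) (by omega)), _, apply_mem_seg (by omega)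
        (by omega), h.symm⟩
    · exact (H.touch_b hac (Or.inl (H.last_mem_seg (by omega))) (H.b_mem_seg_left hbc.symm))
    · exact (H.touch_b had (Or.inr (H.last_mem_seg (by omega)))
        (Or.inl (H.b_mem_seg_left hbd.symm)))
    · exact (H.touch_b hbc.symm (H.last_mem_seg (by omega)) (H.b_mem_seg_right hab (by omega))).symm
    · exact (H.touch_b hbd.symm (Or.inl (H.last_mem_seg (by omega)))
        (H.b_mem_seg_right hab (by omega))).symm
    · exact (H.touch_b hcd.symm (Or.inr (H.last_mem_seg (by omega)))
        (H.b_mem_seg_left hbc.symm)).symm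

/-- The interior of `ac` does not have neighbors on both `ab - a` and `ad - a`. -/
theorem Tight.not_adj_both (hH : H.Tight) {a b c d : Fin 4} (hab : a ≠ b) (hac : a ≠ c)
    (had : a ≠ d) (hbc : b ≠ c) (hbd : b ≠ d) (hcd : c ≠ d)
    {s t s' t' : ℕ} (hs : 1 ≤ s) (hsn : s ≤ H.n a b) (ht : 1 ≤ t) (htn : t < H.n a c)
    (h : G.Adj (H.p a b s) (H.p a c t)) (hs' : 1 ≤ s') (hsn' : s' ≤ H.n a d) (ht' : 1 ≤ t')
    (htn' : t' < H.n a c) (h' : G.Adj (H.p a d s') (H.p a c t')) : False := by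
  have n0 := H.n_pos _ _ hab
  have n1 := H.n_pos _ _ hac
  have n2 := H.n_pos _ _ had
  have n3 := H.n_pos _ _ hbc
  have n4 := H.n_pos _ _ hbd
  have n5 := H.n_pos _ _ hcd
  -- The omitted vertex is `a` itself: the interior of `ac` takes over its role, reaching `b` and
  -- `d` through the two chords.
  refine hH.false_of_sets (s := 0) hab (by omega)
    (seg (H.p a c) 1 (H.n a c - 1))
    (seg (H.p a b) s (H.n a b) ∪ seg (H.p b d) 0 (H.n b d - 1) ∪ seg (H.p b c) 0 (H.n b c - 1))
    (seg (H.p c d) 0 (H.n c d - 1))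
    (seg (H.p a d) s' (H.n a d)) ?_ ?_ ?_ ?_
  · simp only [Set.union_subset_iff]
    repeat' apply And.intro
    all_goals apply H.seg_subset <;> omega
  · refine ⟨?_, ?_, ?_, ?_⟩
    · exact H.seg_connected hac (by omega) (by omega)
    · exact connected_union (connected_union (H.seg_connected hab (by omega) (by omega))
        (H.seg_connected hbd (by omega) (by omega))
        (H.b b) (H.b_mem_seg_right hab (by omega)) (H.b_mem_seg_left hbd))
        (H.seg_connected hbc (by omega) (by omega))
        (H.b b) (Or.inl (H.b_mem_seg_right hab (by omega))) (H.b_mem_seg_left hbc)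
    · exact H.seg_connected hcd (by omega) (by omega)
    · exact H.seg_connected had (by omega) (by omega)
  · simp only [Set.disjoint_union_left, Set.disjoint_union_right]
    repeat' apply And.intro
    all_goals first
      | (apply H.disjoint_seg_same <;> omega)
      | (apply H.disjoint_seg <;> grind)
  · refine ⟨?_, ?_, ?_, ?_, ?_, ?_⟩
    · exact ⟨_, apply_mem_seg (by omega) (by omega), _, Or.inl
        (Or.inl (apply_mem_seg (by omega) (by omega))), h.symm⟩
    · exact (H.touch_b hac (H.last_mem_seg (by omega)) (H.b_mem_seg_left hcd))
    · exact ⟨_, apply_mem_seg (by omega) (by omega), _, apply_mem_seg (by omega) (by omega),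
        h'.symm⟩
    · exact (H.touch_b hbc (Or.inr (H.last_mem_seg (by omega))) (H.b_mem_seg_left hcd))
    · exact (H.touch_b hbd (Or.inl (Or.inr (H.last_mem_seg (by omega))))
        (H.b_mem_seg_right had (by omega)))
    · exact (H.touch_b hcd (H.last_mem_seg (by omega)) (H.b_mem_seg_right had (by omega)))

/-- If `a` and its neighbors on `ab` and `ac` form a triangle, then `bc` is an edge. -/
theorem Tight.opposite_side_eq_one (hH : H.Tight) {a b c d : Fin 4} (hab : a ≠ b) (hac : a ≠ c)
    (had : a ≠ d) (hbc : b ≠ c) (hbd : b ≠ d) (hcd : c ≠ d)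
    (hb : 2 ≤ H.n a b) (hc : 2 ≤ H.n a c) (h : G.Adj (H.p a b 1) (H.p a c 1)) : H.n b c = 1 := by
  have n0 := H.n_pos _ _ hab
  have n1 := H.n_pos _ _ hac
  have n2 := H.n_pos _ _ had
  have n3 := H.n_pos _ _ hbd.symm
  have n4 := H.n_pos _ _ hcd.symm
  have nbc := H.n_pos _ _ hbc
  by_contra hlen
  -- The edge `h` joins the bags of `b` and `c`, so the interior of `bc` is not needed.
  refine hH.false_of_sets (s := 1) hbc (by omega)
    (seg (H.p a d) 0 (H.n a d - 1))
    (seg (H.p a b) 1 (H.n a b))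
    (seg (H.p a c) 1 (H.n a c))
    (seg (H.p d b) 0 (H.n d b - 1) ∪ seg (H.p d c) 0 (H.n d c - 1)) ?_ ?_ ?_ ?_
  · simp only [Set.union_subset_iff]
    repeat' apply And.intro
    all_goals apply H.seg_subset <;> omega
  · refine ⟨?_, ?_, ?_, ?_⟩
    · exact H.seg_connected had (by omega) (by omega)
    · exact H.seg_connected hab (by omega) (by omega)
    · exact H.seg_connected hac (by omega) (by omega)
    · exact connected_union (H.seg_connected hbd.symm (by omega) (by omega))
        (H.seg_connected hcd.symm (by omega) (by omega))
        (H.b d) (H.b_mem_seg_left hbd.symm) (H.b_mem_seg_left hcd.symm)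
  · simp only [Set.disjoint_union_left, Set.disjoint_union_right]
    repeat' apply And.intro
    all_goals apply H.disjoint_seg <;> grind
  · refine ⟨?_, ?_, ?_, ?_, ?_, ?_⟩
    · exact ⟨_, H.b_mem_seg_left had, _, apply_mem_seg le_rfl (by omega), H.adj_b_left hab⟩
    · exact ⟨_, H.b_mem_seg_left had, _, apply_mem_seg le_rfl (by omega), H.adj_b_left hac⟩
    · exact (H.touch_b had (H.last_mem_seg (by omega)) (Or.inl (H.b_mem_seg_left hbd.symm)))
    · exact ⟨_, apply_mem_seg le_rfl (by omega), _, apply_mem_seg le_rfl (by omega), h⟩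
    · exact (H.touch_b hbd.symm (Or.inl (H.last_mem_seg (by omega)))
        (H.b_mem_seg_right hab (by omega))).symm
    · exact (H.touch_b hcd.symm (Or.inr (H.last_mem_seg (by omega)))
        (H.b_mem_seg_right hac (by omega))).symm

/-- If `a` and its neighbors on `ab` and `ac` form a triangle, then `bd` is an edge. -/
theorem Tight.other_side_eq_one (hH : H.Tight) {a b c d : Fin 4} (hab : a ≠ b) (hac : a ≠ c)
    (had : a ≠ d) (hbc : b ≠ c) (hbd : b ≠ d) (hcd : c ≠ d)
    (hb : 2 ≤ H.n a b) (hc : 2 ≤ H.n a c) (h : G.Adj (H.p a b 1) (H.p a c 1)) : H.n b d = 1 := by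
  have n0 := H.n_pos _ _ hab
  have n1 := H.n_pos _ _ hac
  have n2 := H.n_pos _ _ had
  have n3 := H.n_pos _ _ hbc.symm
  have n4 := H.n_pos _ _ hcd
  have nbd := H.n_pos _ _ hbd
  by_contra hlen
  -- Here `ad` is contracted to one bag and the interior of `ac` becomes a bag of its own. This
  -- makes the interior of `bd` superfluous.
  refine hH.false_of_sets (s := 1) hbd (by omega)
    (seg (H.p a d) 0 (H.n a d))
    (seg (H.p a b) 1 (H.n a b))
    (seg (H.p a c) 1 (H.n a c - 1))
    (seg (H.p c b) 0 (H.n c b - 1) ∪ seg (H.p c d) 0 (H.n c d - 1)) ?_ ?_ ?_ ?_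
  · simp only [Set.union_subset_iff]
    repeat' apply And.intro
    all_goals apply H.seg_subset <;> omega
  · refine ⟨?_, ?_, ?_, ?_⟩
    · exact H.seg_connected had (by omega) (by omega)
    · exact H.seg_connected hab (by omega) (by omega)
    · exact H.seg_connected hac (by omega) (by omega)
    · exact connected_union (H.seg_connected hbc.symm (by omega) (by omega))
        (H.seg_connected hcd (by omega) (by omega))
        (H.b c) (H.b_mem_seg_left hbc.symm) (H.b_mem_seg_left hcd)
  · simp only [Set.disjoint_union_left, Set.disjoint_union_right]
    repeat' apply And.intro
    all_goals apply H.disjoint_seg <;> grind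
  · refine ⟨?_, ?_, ?_, ?_, ?_, ?_⟩
    · exact ⟨_, H.b_mem_seg_left had, _, apply_mem_seg le_rfl (by omega), H.adj_b_left hab⟩
    · exact ⟨_, H.b_mem_seg_left had, _, apply_mem_seg le_rfl (by omega), H.adj_b_left hac⟩
    · exact (H.touch_b hcd (Or.inr (H.last_mem_seg (by omega)))
        (H.b_mem_seg_right had (by omega))).symm
    · exact ⟨_, apply_mem_seg le_rfl (by omega), _, apply_mem_seg le_rfl (by omega), h⟩
    · exact (H.touch_b hbc.symm (Or.inl (H.last_mem_seg (by omega)))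
        (H.b_mem_seg_right hab (by omega))).symm
    · exact (H.touch_b hac (H.last_mem_seg (by omega)) (Or.inl (H.b_mem_seg_left hbc.symm)))

/-- If there is a chord between the interiors of `ab` and `cd`, then `ac` is an edge. -/
theorem Tight.cross_eq_one (hH : H.Tight) {a b c d : Fin 4} (hab : a ≠ b) (hac : a ≠ c)
    (had : a ≠ d) (hbc : b ≠ c) (hbd : b ≠ d) (hcd : c ≠ d)
    {s t : ℕ} (hs : 1 ≤ s) (hsn : s < H.n a b) (ht : 1 ≤ t) (htn : t < H.n c d)
    (h : G.Adj (H.p a b s) (H.p c d t)) : H.n a c = 1 := by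
  have n0 := H.n_pos _ _ hab
  have n1 := H.n_pos _ _ had
  have n2 := H.n_pos _ _ hbc.symm
  have n3 := H.n_pos _ _ hcd
  have n4 := H.n_pos _ _ hbd.symm
  have nac := H.n_pos _ _ hac
  by_contra hlen
  -- The chord joins the bags of `a` and `c` and so replaces the path between them.
  refine hH.false_of_sets (s := 1) hac (by omega)
    (seg (H.p a b) 0 s ∪ seg (H.p a d) 0 (H.n a d - 1))
    (seg (H.p a b) (s + 1) (H.n a b))
    (seg (H.p c d) 0 t ∪ seg (H.p c b) 0 (H.n c b - 1))
    (seg (H.p c d) (t + 1) (H.n c d) ∪ seg (H.p d b) 0 (H.n d b - 1)) ?_ ?_ ?_ ?_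
  · simp only [Set.union_subset_iff]
    repeat' apply And.intro
    all_goals apply H.seg_subset <;> omega
  · refine ⟨?_, ?_, ?_, ?_⟩
    · exact connected_union (H.seg_connected hab (by omega) (by omega))
        (H.seg_connected had (by omega) (by omega))
        (H.b a) (H.b_mem_seg_left hab) (H.b_mem_seg_left had)
    · exact H.seg_connected hab (by omega) (by omega)
    · exact connected_union (H.seg_connected hcd (by omega) (by omega))
        (H.seg_connected hbc.symm (by omega) (by omega))
        (H.b c) (H.b_mem_seg_left hcd) (H.b_mem_seg_left hbc.symm)
    · exact connected_union (H.seg_connected hcd (by omega) (by omega))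
        (H.seg_connected hbd.symm (by omega) (by omega))
        (H.b d) (H.b_mem_seg_right hcd (by omega)) (H.b_mem_seg_left hbd.symm)
  · simp only [Set.disjoint_union_left, Set.disjoint_union_right]
    repeat' apply And.intro
    all_goals first
      | (apply H.disjoint_seg_same <;> omega)
      | (apply H.disjoint_seg <;> grind)
  · refine ⟨?_, ?_, ?_, ?_, ?_, ?_⟩
    · exact ⟨_, Or.inl (apply_mem_seg (by omega) (by omega)), _, apply_mem_seg (by omega)
        (by omega), H.adj a b s hab (by omega)⟩
    · exact ⟨_, Or.inl (apply_mem_seg (by omega) (by omega)), _, Or.inl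
        (apply_mem_seg (by omega) (by omega)), h⟩
    · exact (H.touch_b had (Or.inr (H.last_mem_seg (by omega)))
        (Or.inl (H.b_mem_seg_right hcd (by omega))))
    · exact (H.touch_b hbc.symm (Or.inr (H.last_mem_seg (by omega)))
        (H.b_mem_seg_right hab (by omega))).symm
    · exact (H.touch_b hbd.symm (Or.inr (H.last_mem_seg (by omega)))
        (H.b_mem_seg_right hab (by omega))).symm
    · exact ⟨_, Or.inl (apply_mem_seg (by omega) (by omega)), _, Or.inl
        (apply_mem_seg (by omega) (by omega)), H.adj c d t hcd (by omega)⟩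

/-- A chord between the interiors of `ab` and `cd` starts next to `a`. -/
theorem Tight.opposite_eq_one (hH : H.Tight) {a b c d : Fin 4} (hab : a ≠ b) (hac : a ≠ c)
    (had : a ≠ d) (hbc : b ≠ c) (hbd : b ≠ d) (hcd : c ≠ d)
    {s t : ℕ} (hs : 1 ≤ s) (hsn : s < H.n a b) (ht : 1 ≤ t) (htn : t < H.n c d)
    (h : G.Adj (H.p a b s) (H.p c d t)) : s = 1 := by
  have n0 := H.n_pos _ _ hab
  have n1 := H.n_pos _ _ hac.symm
  have n2 := H.n_pos _ _ hbc.symm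
  have n3 := H.n_pos _ _ hcd
  have n4 := H.n_pos _ _ had.symm
  have n5 := H.n_pos _ _ hbd.symm
  by_contra hlen
  -- The end of the chord on `cd` forms a bag, and `a` is absorbed by the bag of `d`. The start of
  -- `ab` after `a` is then free, and it contains vertex 1 because `s ≥ 2`.
  refine hH.false_of_sets (s := 1) hab (by omega)
    (seg (H.p a b) s (H.n a b))
    (seg (H.p c d) t t)
    (seg (H.p c d) 0 (t - 1) ∪ seg (H.p c a) 0 (H.n c a - 1) ∪ seg (H.p c b) 0 (H.n c b - 1))
    (seg (H.p c d) (t + 1) (H.n c d) ∪ seg (H.p d a) 0 (H.n d a) ∪ seg (H.p d b) 0 (H.n d b - 1)) ?_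
      ?_ ?_ ?_
  · simp only [Set.union_subset_iff]
    repeat' apply And.intro
    all_goals apply H.seg_subset <;> omega
  · refine ⟨?_, ?_, ?_, ?_⟩
    · exact H.seg_connected hab (by omega) (by omega)
    · exact H.seg_connected hcd (by omega) (by omega)
    · exact connected_union (connected_union (H.seg_connected hcd (by omega) (by omega))
        (H.seg_connected hac.symm (by omega) (by omega))
        (H.b c) (H.b_mem_seg_left hcd) (H.b_mem_seg_left hac.symm))
        (H.seg_connected hbc.symm (by omega) (by omega))
        (H.b c) (Or.inl (H.b_mem_seg_left hcd)) (H.b_mem_seg_left hbc.symm)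
    · exact connected_union (connected_union (H.seg_connected hcd (by omega) (by omega))
        (H.seg_connected had.symm (by omega) (by omega))
        (H.b d) (H.b_mem_seg_right hcd (by omega)) (H.b_mem_seg_left had.symm))
        (H.seg_connected hbd.symm (by omega) (by omega))
        (H.b d) (Or.inl (H.b_mem_seg_right hcd (by omega))) (H.b_mem_seg_left hbd.symm)
  · simp only [Set.disjoint_union_left, Set.disjoint_union_right]
    repeat' apply And.intro
    all_goals first
      | (apply H.disjoint_seg_same <;> omega)
      | (apply H.disjoint_seg <;> grind)
  · refine ⟨?_, ?_, ?_, ?_, ?_, ?_⟩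
    · exact ⟨_, apply_mem_seg (by omega) (by omega), _, apply_mem_seg (by omega) (by omega), h⟩
    · exact (H.touch_b hbc.symm (Or.inr (H.last_mem_seg (by omega)))
        (H.b_mem_seg_right hab (by omega))).symm
    · exact (H.touch_b hbd.symm (Or.inr (H.last_mem_seg (by omega)))
        (H.b_mem_seg_right hab (by omega))).symm
    · exact Touch.symm ⟨H.p c d (t - 1), Or.inl (Or.inl (apply_mem_seg (by omega) (by omega))), H.p
        c d t, apply_mem_seg (by omega) (by omega), by
        simpa [Nat.sub_add_cancel ht] using H.adj c d (t - 1) hcd (by omega)⟩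
    · exact ⟨_, apply_mem_seg (by omega) (by omega), _, Or.inl
        (Or.inl (apply_mem_seg (by omega) (by omega))), H.adj c d t hcd (by omega)⟩
    · exact (H.touch_b hac.symm (Or.inl (Or.inr (H.last_mem_seg (by omega))))
        (Or.inl (Or.inr (H.b_mem_seg_right had.symm (by omega)))))

/-- If `a` has a neighbor inside `cd`, then `ab` is an edge. -/
theorem Tight.far_eq_one (hH : H.Tight) {a b c d : Fin 4} (hab : a ≠ b) (hac : a ≠ c)
    (had : a ≠ d) (hbc : b ≠ c) (hbd : b ≠ d) (hcd : c ≠ d)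
    {t : ℕ} (ht : 1 ≤ t) (htn : t < H.n c d) (h : G.Adj (H.b a) (H.p c d t)) : H.n a b = 1 := by
  have n0 := H.n_pos _ _ hac
  have n1 := H.n_pos _ _ had
  have n2 := H.n_pos _ _ hbc
  have n3 := H.n_pos _ _ hcd
  have n4 := H.n_pos _ _ hbd.symm
  have nab := H.n_pos _ _ hab
  by_contra hlen
  -- The neighbor of `a` on `cd` forms a bag, and `b` is absorbed by the bag of `d`, so no bag needs
  -- the interior of `ab`.
  refine hH.false_of_sets (s := 1) hab (by omega)
    (seg (H.p a c) 0 (H.n a c - 1) ∪ seg (H.p a d) 0 (H.n a d - 1))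
    (seg (H.p c d) t t)
    (seg (H.p c d) 0 (t - 1))
    (seg (H.p c d) (t + 1) (H.n c d) ∪ seg (H.p d b) 0 (H.n d b) ∪ seg (H.p b c) 0 (H.n b c - 1)) ?_
      ?_ ?_ ?_
  · simp only [Set.union_subset_iff]
    repeat' apply And.intro
    all_goals apply H.seg_subset <;> omega
  · refine ⟨?_, ?_, ?_, ?_⟩
    · exact connected_union (H.seg_connected hac (by omega) (by omega))
        (H.seg_connected had (by omega) (by omega))
        (H.b a) (H.b_mem_seg_left hac) (H.b_mem_seg_left had)
    · exact H.seg_connected hcd (by omega) (by omega)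
    · exact H.seg_connected hcd (by omega) (by omega)
    · exact connected_union (connected_union (H.seg_connected hcd (by omega) (by omega))
        (H.seg_connected hbd.symm (by omega) (by omega))
        (H.b d) (H.b_mem_seg_right hcd (by omega)) (H.b_mem_seg_left hbd.symm))
        (H.seg_connected hbc (by omega) (by omega))
        (H.b b) (Or.inr (H.b_mem_seg_right hbd.symm (by omega))) (H.b_mem_seg_left hbc)
  · simp only [Set.disjoint_union_left, Set.disjoint_union_right]
    repeat' apply And.intro
    all_goals first
      | (apply H.disjoint_seg_same <;> omega)
      | (apply H.disjoint_seg <;> grind)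
  · refine ⟨?_, ?_, ?_, ?_, ?_, ?_⟩
    · exact ⟨_, Or.inl (H.b_mem_seg_left hac), _, apply_mem_seg le_rfl le_rfl, h⟩
    · exact (H.touch_b hac (Or.inl (H.last_mem_seg (by omega))) (H.b_mem_seg_left hcd))
    · exact (H.touch_b had (Or.inr (H.last_mem_seg (by omega)))
        (Or.inl (Or.inl (H.b_mem_seg_right hcd (by omega)))))
    · exact Touch.symm ⟨H.p c d (t - 1), apply_mem_seg (by omega) (by omega), H.p c d t,
        apply_mem_seg (by omega) (by omega), by
        simpa [Nat.sub_add_cancel ht] using H.adj c d (t - 1) hcd (by omega)⟩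
    · exact ⟨_, apply_mem_seg (by omega) (by omega), _, Or.inl
        (Or.inl (apply_mem_seg (by omega) (by omega))), H.adj c d t hcd (by omega)⟩
    · exact (H.touch_b hbc (Or.inr (H.last_mem_seg (by omega))) (H.b_mem_seg_left hcd)).symm

end K4Sub

/-! ### Passing between minors and subdivisions. -/

variable {G : SimpleGraph V}

/-- A shortest path of `G.induce A` works: a chord that skips vertices would give a shorter walk. -/
theorem exists_induced_path {A : Set V} (hA : (G.induce A).Preconnected) {a c : V} (ha : a ∈ A)
    (hc : c ∈ A) : ∃ (r : ℕ → V) (m : ℕ), r 0 = a ∧ r m = c ∧ (∀ s ≤ m, r s ∈ A) ∧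
      (∀ s < m, G.Adj (r s) (r (s + 1))) ∧ (∀ s t, s ≤ m → t ≤ m → r s = r t → s = t) ∧
      ∀ s t, s < t → t ≤ m → G.Adj (r s) (r t) → t = s + 1 := by
  obtain ⟨w, hw, hl⟩ := (hA ⟨a, ha⟩ ⟨c, hc⟩).exists_path_of_dist
  refine ⟨fun s => w.getVert s, w.length, by simp, by simp, fun s _ => (w.getVert s).2,
    fun s hs => w.adj_getVert_succ hs, fun s t hs ht h => ?_, fun s t hst ht h => ?_⟩
  · exact hw.getVert_injOn hs ht (Subtype.ext h)
  · have h' : (G.induce A).Adj (w.getVert s) (w.getVert t) := h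
    have := dist_le (((w.take s).concat h').append (w.drop t))
    simp only [Walk.length_append, Walk.length_concat, Walk.take_length, Walk.drop_length] at this
    omega

/-- Three vertices of a connected set are joined by three paths that start at a common vertex and
are disjoint otherwise. -/
theorem exists_tripod {A : Set V} (hA : (G.induce A).Preconnected) (i : Fin 4) (t : Fin 4 → V)
    (ht : ∀ j, j ≠ i → t j ∈ A) :
    ∃ (L : Fin 4 → ℕ → V) (l : Fin 4 → ℕ) (c : V), (∀ j, j ≠ i → L j 0 = c) ∧
      (∀ j, j ≠ i → L j (l j) = t j) ∧ (∀ j s, j ≠ i → s ≤ l j → L j s ∈ A) ∧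
      (∀ j s, j ≠ i → s < l j → G.Adj (L j s) (L j (s + 1))) ∧
      ∀ j s k s', j ≠ i → k ≠ i → s ≤ l j → s' ≤ l k → L j s = L k s' →
        (j = k ∧ s = s') ∨ (s = 0 ∧ s' = 0) := by
  obtain ⟨j, k, l, hj, hk, hl, hjk, hjl, hkl, hall⟩ : ∃ j k l : Fin 4, j ≠ i ∧ k ≠ i ∧ l ≠ i ∧
      j ≠ k ∧ j ≠ l ∧ k ≠ l ∧ ∀ x, x ≠ i → x = j ∨ x = k ∨ x = l := by
    clear ht
    revert i
    decide
  obtain ⟨r, m, r0, rm, rA, radj, rinj, -⟩ := exists_induced_path hA (ht j hj) (ht k hk)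
  obtain ⟨q, m', q0, qm, qA, qadj, qinj, -⟩ := exists_induced_path hA (ht l hl) (ht j hj)
  classical
  -- The path `q` ends on `r`, namely at `r 0 = t j`. Its first vertex on `r` is the center of the
  -- tripod; two legs run along `r` in opposite directions, the third runs back along `q`. Legs may
  -- have length zero.
  have hex : ∃ s, s ≤ m' ∧ ∃ u ≤ m, r u = q s := ⟨m', le_rfl, 0, Nat.zero_le _, by rw [r0, qm]⟩
  obtain ⟨hs, u, hu, e⟩ := Nat.find_spec hex
  have hmin : ∀ x, x < Nat.find hex → ∀ u ≤ m, r u ≠ q x := fun x hx u hu e =>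
    Nat.find_min hex hx ⟨by omega, u, hu, e⟩
  generalize Nat.find hex = s at *
  refine ⟨fun x y => if x = j then r (u - y) else if x = k then r (u + y) else q (s - y),
    fun x => if x = j then u else if x = k then m - u else s, r u, ?_, ?_, ?_, ?_, ?_⟩
  · intro x hx
    rcases hall x hx with rfl | rfl | rfl <;> simp [*]
  · intro x hx
    rcases hall x hx with rfl | rfl | rfl
    · simp [r0]
    · simp [hjk.symm, Nat.add_sub_cancel' hu, rm]
    · simp [hjl.symm, hkl.symm, q0]
  · intro x y hx
    rcases hall x hx with rfl | rfl | rfl <;> grind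
  · intro x y hx hy
    have key : ∀ (f : ℕ → V) (m : ℕ), (∀ s < m, G.Adj (f s) (f (s + 1))) → ∀ z y, z ≤ m →
        y < z → G.Adj (f (z - y)) (f (z - (y + 1))) := by
      intro f m h z y hz hy
      have := h (z - (y + 1)) (by omega)
      rw [show z - (y + 1) + 1 = z - y by omega] at this
      exact this.symm
    rcases hall x hx with rfl | rfl | rfl
    · simp only [if_true] at hy ⊢
      exact key r m radj u y hu hy
    · simp only [if_neg hjk.symm, if_true] at hy ⊢
      exact radj (u + y) (by omega)
    · simp only [if_neg hjl.symm, if_neg hkl.symm] at hy ⊢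
      exact key q m' qadj s y hs hy
  · intro x y x' y' hx hx' hy hy' h
    rcases hall x hx with rfl | rfl | rfl <;> rcases hall x' hx' with rfl | rfl | rfl <;> grind

/-- Each bag has one contact vertex for each of the three other bags. A tripod inside the bag joins
these, and its center becomes a branch vertex. -/
theorem HasK4Minor.exists_k4Sub {X : Set V} (h : G.HasK4Minor X) :
    ∃ H : K4Sub G, H.verts ⊆ X := by
  obtain ⟨A, hX, hc, hd, ha⟩ := h
  have hT : ∃ t : Fin 4 → Fin 4 → V, (∀ i j, i ≠ j → t i j ∈ A i) ∧
      ∀ i j, i ≠ j → G.Adj (t i j) (t j i) := by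
    -- One edge is chosen per unordered pair of bags, so that `t i j` and `t j i` will be the two
    -- ends of the same edge.
    have : ∀ i j, ∃ e : V × V, i < j → e.1 ∈ A i ∧ e.2 ∈ A j ∧ G.Adj e.1 e.2 := by
      intro i j
      by_cases hij : i < j
      · obtain ⟨u, hu, v, hv, h⟩ := ha i j hij.ne
        exact ⟨(u, v), fun _ => ⟨hu, hv, h⟩⟩
      · obtain ⟨u⟩ := (hc i).nonempty
        exact ⟨(u, u), fun h => absurd h hij⟩
    choose e he using this
    refine ⟨fun i j => if i < j then (e i j).1 else (e j i).2, fun i j hij => ?_, fun i j hij => ?_⟩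
    · rcases lt_or_gt_of_ne hij with h | h
      · simpa [h] using (he i j h).1
      · simpa [h.not_gt] using (he j i h).2.1
    · rcases lt_or_gt_of_ne hij with h | h
      · simpa [h, h.not_gt] using (he i j h).2.2
      · simpa [h, h.not_gt] using (he j i h).2.2.symm
  obtain ⟨t, htA, htadj⟩ := hT
  choose L l c L0 Ll LA Ladj Linj using fun i =>
    exists_tripod (hc i).preconnected i (t i) fun j hj => htA i j hj.symm
  have hne : ∀ i j x y, i ≠ j → x ∈ A i → y ∈ A j → x ≠ y := by
    rintro i j x y hij hx hy rfl
    exact Set.disjoint_left.1 (hd i j hij) hx hy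
  have hcA : ∀ i, c i ∈ A i := by
    intro i
    obtain ⟨j, hj⟩ : ∃ j, j ≠ i := exists_ne i
    rw [← L0 i j hj]
    exact LA i j 0 hj (Nat.zero_le _)
  -- The path from `c i` to `c j` consists of a leg in bag `i`, the contact edge, and a reversed leg
  -- in bag `j`; the `1` in its length counts the contact edge.
  refine ⟨⟨c, fun i j => l i j + 1 + l j i,
    fun i j s => if s ≤ l i j then L i j s else L j i (l i j + 1 + l j i - s),
    fun i j => by omega, fun i j _ => by omega, fun i j hij => by simp [L0 i j hij.symm],
    ?_, ?_, ?_, ?_, ?_⟩, ?_⟩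
  · intro i j s hij hs
    by_cases h : s ≤ l j i
    · rw [if_pos h, if_neg (by omega)]
      congr 1; omega
    · rw [if_neg h, if_pos (by omega)]
      congr 1; omega
  · intro i j s hij hs
    rcases lt_trichotomy s (l i j) with h | h | h
    · rw [if_pos h.le, if_pos (by omega)]
      exact Ladj i j s hij.symm h
    · rw [if_pos h.le, if_neg (by omega), h, Ll i j hij.symm,
        show l i j + 1 + l j i - (l i j + 1) = l j i by omega, Ll j i hij]
      exact htadj i j hij
    · rw [if_neg (by omega), if_neg (by omega)]
      have := Ladj j i (l i j + 1 + l j i - (s + 1)) hij (by omega)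
      rw [show l i j + 1 + l j i - (s + 1) + 1 = l i j + 1 + l j i - s by omega] at this
      exact this.symm
  · intro i j h
    by_contra hij
    exact hne i j _ _ hij (hcA i) (hcA j) h
  · intro i j s k hij hs hsn
    have key : ∀ i j s, i ≠ j → 0 < s → s ≤ l i j → L i j s ≠ c k := by
      intro i j s hij hs hsl h
      by_cases hik : i = k
      · subst hik
        rw [← L0 i j hij.symm] at h
        have := Linj i j s j 0 hij.symm hij.symm hsl (Nat.zero_le _) h
        omega
      · exact hne i k _ _ hik (LA i j s hij.symm hsl) (hcA k) h
    split_ifs with h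
    · exact key i j s hij hs h
    · exact key j i _ hij.symm (by omega) (by omega)
  · intro i j s i' j' s' hij hij' hs hsn hs' hsn' h
    have key : ∀ i j s i' j' s', i ≠ j → i' ≠ j' → 0 < s → s ≤ l i j → 0 < s' → s' ≤ l i' j' →
        L i j s = L i' j' s' → i = i' ∧ j = j' ∧ s = s' := by
      intro i j s i' j' s' hij hij' hs hsn hs' hsn' h
      by_cases hii : i = i'
      · subst hii
        have := Linj i j s j' s' hij.symm hij'.symm hsn hsn' h
        omega
      · exact absurd h (hne i i' _ _ hii (LA i j s hij.symm hsn) (LA i' j' s' hij'.symm hsn'))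
    split_ifs at h with h₁ h₂ h₂
    · exact Or.inl (key _ _ _ _ _ _ hij hij' hs h₁ hs' h₂ h)
    · obtain ⟨rfl, rfl, h⟩ := key _ _ _ _ _ _ hij hij'.symm hs h₁ (by omega) (by omega) h
      exact Or.inr ⟨rfl, rfl, by omega⟩
    · obtain ⟨rfl, rfl, h⟩ := key _ _ _ _ _ _ hij.symm hij' (by omega) (by omega) hs' h₂ h
      exact Or.inr ⟨rfl, rfl, by omega⟩
    · obtain ⟨rfl, rfl, h⟩ := key _ _ _ _ _ _ hij.symm hij'.symm (by omega) (by omega) (by omega)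
        (by omega) h
      exact Or.inl ⟨rfl, rfl, by omega⟩
  · rintro _ ⟨i, j, s, hij, hs, rfl⟩
    dsimp only at hs ⊢
    split_ifs with h
    · exact hX i (LA i j s hij.symm h)
    · exact hX j (LA j i _ hij (by omega))

theorem Subgraph.hasK4Minor_of_isSubdivisionOf {S : G.Subgraph}
    (h : S.coe.IsSubdivisionOf (completeGraph (Fin 4))) : G.HasK4Minor Set.univ := by
  obtain ⟨f, p, finj, hpath, hrev, hbr, hdis, -, -⟩ := h
  have hlen : ∀ i j (h : i ≠ j), 0 < (p i j h).length := by
    intro i j h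
    by_contra h0
    exact h (finj (Walk.eq_of_length_eq_zero (p := p i j h) (by omega)))
  have hrl : ∀ i j (h : i ≠ j), (p j i h.symm).length = (p i j h).length := by
    intro i j h
    rw [hrev i j h, Walk.length_reverse]
  let H : K4Sub G := {
    b := fun i => f i
    n := fun i j => if h : i ≠ j then (p i j h).length else 0
    p := fun i j s => if h : i ≠ j then ((p i j h).getVert s : V) else f i
    n_symm := by
      intro i j
      by_cases h : i = j
      · simp [h]
      · simp only [dif_pos h, dif_pos (Ne.symm h), ne_eq]
        rw [hrl i j h]
    n_pos := by
      intro i j h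
      simpa [dif_pos h] using hlen i j h
    p_zero := by
      intro i j h
      simp [h]
    p_symm := by
      intro i j s h hs
      simp only [dif_pos h, dif_pos h.symm]
      rw [hrev i j h, Walk.getVert_reverse]
    adj := by
      intro i j s h hs
      simp only [dif_pos h] at hs ⊢
      exact Subgraph.coe_adj_sub _ _ _ ((p i j h).adj_getVert_succ hs)
    b_inj := fun i j h => finj (Subtype.ext h)
    p_ne_b := by
      intro i j s k h hs hsn e
      simp only [dif_pos h] at hsn e
      have e := Subtype.ext e
      rcases hbr i j h k (e ▸ Walk.getVert_mem_support _ _) with rfl | rfl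
      · have := ((hpath _ _ h).getVert_eq_start_iff hsn.le).1 e
        omega
      · have := ((hpath _ _ h).getVert_eq_end_iff hsn.le).1 e
        omega
    p_inj := by
      intro i j s i' j' t h h' hs hsn ht htn e
      simp only [dif_pos h, dif_pos h'] at hsn htn e ⊢
      have e := Subtype.ext e
      by_cases hs2 : s(i, j) = s(i', j')
      · rcases Sym2.eq_iff.1 hs2 with ⟨rfl, rfl⟩ | ⟨rfl, rfl⟩
        · exact Or.inl ⟨rfl, rfl, (hpath _ _ h).getVert_injOn hsn.le htn.le e⟩
        · rw [hrev i j h, Walk.getVert_reverse] at e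
          have hl := hrl i j h
          have := (hpath i j h).getVert_injOn (x₁ := s) (x₂ := (p i j h).length - t) hsn.le
            (Nat.sub_le _ _) e
          exact Or.inr ⟨rfl, rfl, by omega⟩
      · obtain ⟨k, hk⟩ := hdis i j h i' j' h' hs2 _ (Walk.getVert_mem_support _ _)
          (by rw [e]; exact Walk.getVert_mem_support _ _)
        rcases hbr i j h k (hk ▸ Walk.getVert_mem_support _ _) with rfl | rfl
        · have := ((hpath _ _ h).getVert_eq_start_iff hsn.le).1 hk
          omega
        · have := ((hpath _ _ h).getVert_eq_end_iff hsn.le).1 hk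
          omega }
  exact H.hasK4Minor_verts.mono (Set.subset_univ _)

/-! ### Induced subdivisions and wheels built from vertex sequences. -/

/-- The walk `w` of an induced subgraph runs through `f 0, …, f n`. -/
def Walk.Follows {X : Set V} {K : SimpleGraph X} {a c : X} (w : K.Walk a c) (f : ℕ → V) (n : ℕ) :
    Prop :=
  w.length = n ∧ ∀ s ≤ n, (w.getVert s : V) = f s

theorem exists_walk_follows {X : Set V} (f : ℕ → V) (n : ℕ) (hX : ∀ s ≤ n, f s ∈ X)
    (hadj : ∀ s < n, G.Adj (f s) (f (s + 1))) (a c : X) (ha : f 0 = a) (hc : f n = c) :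
    ∃ w : (G.induce X).Walk a c, w.Follows f n := by
  induction n generalizing c with
  | zero =>
    obtain rfl : a = c := Subtype.ext (ha.symm.trans hc)
    exact ⟨Walk.nil, rfl, fun s hs => by simp [Nat.le_zero.1 hs, ha]⟩
  | succ n ih =>
    obtain ⟨w, hl, hw⟩ := ih (fun s hs => hX s (by omega)) (fun s hs => hadj s (by omega))
      ⟨f n, hX n (by omega)⟩ rfl
    have h : (G.induce X).Adj ⟨f n, hX n (by omega)⟩ c := by
      have := hadj n (by omega)
      rw [hc] at this
      exact this
    refine ⟨w.concat h, by simp [hl], fun s hs => ?_⟩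
    rw [Walk.concat_eq_append, Walk.getVert_append]
    split_ifs with h'
    · exact hw s (by omega)
    · by_cases hs' : s = n
      · simp [hs', hl]
      · have : s = n + 1 := by omega
        simp [this, hl, hc]

namespace Walk.Follows

variable {X : Set V} {K : SimpleGraph X} {a c : X} {w : K.Walk a c} {f : ℕ → V} {n : ℕ}

theorem mem_support (h : w.Follows f n) {x : X} : x ∈ w.support ↔ ∃ s ≤ n, f s = x := by
  rw [Walk.mem_support_iff_exists_getVert]
  constructor
  · rintro ⟨s, rfl, hs⟩
    rw [h.1] at hs
    exact ⟨s, hs, (h.2 s hs).symm⟩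
  · rintro ⟨s, hs, e⟩
    exact ⟨s, Subtype.ext ((h.2 s hs).trans e), by rwa [h.1]⟩

theorem isPath (h : w.Follows f n) (hf : ∀ s t, s ≤ n → t ≤ n → f s = f t → s = t) :
    w.IsPath := by
  rw [← Walk.IsPath.getVert_injOn_iff]
  intro s hs t ht e
  have hs : s ≤ n := h.1 ▸ hs
  have ht : t ≤ n := h.1 ▸ ht
  refine hf s t hs ht ?_
  rw [← h.2 s hs, ← h.2 t ht, e]

theorem mem_edges (h : w.Follows f n) {x y : X} {s : ℕ} (hs : s < n)
    (e : s((x : V), (y : V)) = s(f s, f (s + 1))) : s(x, y) ∈ w.edges := by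
  rw [← Walk.adj_toSubgraph_iff_mem_edges, Walk.toSubgraph_adj_iff]
  refine ⟨s, ?_, by rwa [h.1]⟩
  rw [← h.2 s hs.le, ← h.2 (s + 1) hs] at e
  rw [Sym2.eq_iff] at e ⊢
  rcases e with ⟨e, e'⟩ | ⟨e, e'⟩
  · exact Or.inl ⟨Subtype.ext e.symm, Subtype.ext e'.symm⟩
  · exact Or.inr ⟨Subtype.ext e'.symm, Subtype.ext e.symm⟩

theorem mem_edges_of_adj {G : SimpleGraph V} {w : (G.induce X).Walk a c} (h : w.Follows f n)
    (hf : ∀ s t, s < t → t ≤ n → G.Adj (f s) (f t) → t = s + 1) {x y : X}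
    (hx : x ∈ w.support) (hy : y ∈ w.support) (hxy : G.Adj x y) : s(x, y) ∈ w.edges := by
  obtain ⟨s, hs, e⟩ := h.mem_support.1 hx
  obtain ⟨t, ht, e'⟩ := h.mem_support.1 hy
  rw [← e, ← e'] at hxy
  rcases lt_trichotomy s t with hst | rfl | hst
  · obtain rfl := hf s t hst ht hxy
    exact h.mem_edges (s := s) (by omega) (by rw [e, e'])
  · exact absurd hxy G.irrefl
  · obtain rfl := hf t s hst hs hxy.symm
    exact h.mem_edges (s := t) (by omega) (by rw [e, e', Sym2.eq_swap])

end Walk.Follows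

theorem K4Sub.b_mem_verts (H : K4Sub G) (i : Fin 4) : H.b i ∈ H.verts := by
  obtain ⟨j, hj⟩ : ∃ j, j ≠ i := exists_ne i
  exact ⟨i, j, 0, hj.symm, Nat.zero_le _, H.p_zero i j hj.symm⟩

/-- The hypothesis says that every edge on the vertices of `H` lies on a branch path, so the induced
subgraph has no edges beyond the subdivision. -/
theorem K4Sub.isSubdivisionOf (H : K4Sub G)
    (h : ∀ x ∈ H.verts, ∀ y ∈ H.verts, G.Adj x y →
      ∃ i j s, i ≠ j ∧ s < H.n i j ∧ s(x, y) = s(H.p i j s, H.p i j (s + 1))) :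
    (G.induce H.verts).IsSubdivisionOf (completeGraph (Fin 4)) := by
  have hw : ∀ i j, i ≠ j → ∃ w : (G.induce H.verts).Walk ⟨H.b i, H.b_mem_verts i⟩
      ⟨H.b j, H.b_mem_verts j⟩, w.Follows (H.p i j) (H.n i j) := fun i j hij =>
    exists_walk_follows (X := H.verts) _ _ (fun s hs => ⟨i, j, s, hij, hs, rfl⟩)
      (fun s hs => H.adj i j s hij hs) _ _ (H.p_zero i j hij) (H.p_n hij)
  choose p hp using hw
  refine ⟨fun i => ⟨H.b i, H.b_mem_verts i⟩, p, ?_, ?_, ?_, ?_, ?_, ?_, ?_⟩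
  · intro i j hij
    exact H.b_inj (congrArg Subtype.val hij)
  · intro i j hij
    exact (hp i j hij).isPath fun s t hs ht e => H.p_inj_same hij hs ht e
  · intro i j hij
    have h₁ := hp i j hij
    have h₂ := hp j i hij.symm
    refine Walk.ext_getVert_le_length (by rw [Walk.length_reverse, h₁.1, h₂.1, H.n_symm]) ?_
    intro s hs
    rw [h₂.1, H.n_symm] at hs
    apply Subtype.ext
    rw [Walk.getVert_reverse, h₂.2 s (by rwa [H.n_symm]), h₁.1, h₁.2 _ (Nat.sub_le _ _)]
    exact H.p_symm i j s hij hs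
  · intro i j hij k hk
    obtain ⟨s, hs, e⟩ := (hp i j hij).mem_support.1 hk
    rcases Nat.eq_zero_or_pos s with rfl | hs0
    · rw [H.p_zero i j hij] at e
      exact Or.inl (H.b_inj e).symm
    rcases hs.eq_or_lt with rfl | hsn
    · rw [H.p_n hij] at e
      exact Or.inr (H.b_inj e).symm
    · exact absurd e (H.p_ne_b i j s k hij hs0 hsn)
  · intro i j hij i' j' hij' hne v hv hv'
    obtain ⟨s, hs, e⟩ := (hp i j hij).mem_support.1 hv
    obtain ⟨t, ht, e'⟩ := (hp i' j' hij').mem_support.1 hv'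
    rcases Nat.eq_zero_or_pos s with rfl | hs0
    · exact ⟨i, Subtype.ext (e ▸ H.p_zero i j hij)⟩
    rcases hs.eq_or_lt with rfl | hsn
    · exact ⟨j, Subtype.ext (e ▸ H.p_n hij)⟩
    rcases Nat.eq_zero_or_pos t with rfl | ht0
    · exact ⟨i', Subtype.ext (e' ▸ H.p_zero i' j' hij')⟩
    rcases ht.eq_or_lt with rfl | htn
    · exact ⟨j', Subtype.ext (e' ▸ H.p_n hij')⟩
    exfalso
    apply hne
    rw [Sym2.eq_iff]
    rcases H.p_inj i j s i' j' t hij hij' hs0 hsn ht0 htn (e.trans e'.symm) with h | h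
    · exact Or.inl ⟨h.1, h.2.1⟩
    · exact Or.inr ⟨h.1, h.2.1⟩
  · rintro ⟨v, i, j, s, hij, hs, e⟩
    exact Or.inr ⟨i, j, hij, (hp i j hij).mem_support.2 ⟨s, hs, e⟩⟩
  · intro e
    induction e using Sym2.ind with
    | _ x y =>
      intro hxy
      obtain ⟨i, j, s, hij, hs, e⟩ := h x x.2 y y.2 hxy
      exact ⟨i, j, hij, (hp i j hij).mem_edges hs e⟩

/-- The rim is `f` followed by the reverse of `r`, and the hub `z` has the neighbors `a`, `f t` and
`c` on it. -/
theorem exists_isWheel [Finite V] {a c z : V} {f r : ℕ → V} {n m t : ℕ}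
    (f0 : f 0 = a) (fn : f n = c) (fadj : ∀ s < n, G.Adj (f s) (f (s + 1)))
    (finj : ∀ s t, s ≤ n → t ≤ n → f s = f t → s = t)
    (find : ∀ s t, s < t → t ≤ n → G.Adj (f s) (f t) → t = s + 1)
    (r0 : r 0 = a) (rm : r m = c) (radj : ∀ s < m, G.Adj (r s) (r (s + 1)))
    (rinj : ∀ s t, s ≤ m → t ≤ m → r s = r t → s = t)
    (rind : ∀ s t, s < t → t ≤ m → G.Adj (r s) (r t) → t = s + 1)
    (hne : ∀ s t, 0 < s → s < n → 0 < t → t < m → f s ≠ r t)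
    (hnadj : ∀ s t, 0 < s → s < n → 0 < t → t < m → ¬ G.Adj (f s) (r t))
    (hzf : ∀ s ≤ n, f s ≠ z) (hzr : ∀ s ≤ m, r s ≠ z)
    (hza : G.Adj z a) (hzc : G.Adj z c) (ht : 0 < t) (htn : t < n) (hzt : G.Adj z (f t)) :
    ∃ X : Set V, (G.induce X).IsWheel := by
  let X : Set V := {v | v = z ∨ (∃ s ≤ n, f s = v) ∨ ∃ s ≤ m, r s = v}
  have hfX : ∀ s ≤ n, f s ∈ X := fun s hs => Or.inr (Or.inl ⟨s, hs, rfl⟩)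
  have hrX : ∀ s ≤ m, r s ∈ X := fun s hs => Or.inr (Or.inr ⟨s, hs, rfl⟩)
  have haX : a ∈ X := f0 ▸ hfX 0 (Nat.zero_le _)
  have hcX : c ∈ X := fn ▸ hfX n le_rfl
  have hzX : z ∈ X := Or.inl rfl
  obtain ⟨p, hp⟩ := exists_walk_follows f n hfX fadj ⟨a, haX⟩ ⟨c, hcX⟩ f0 fn
  obtain ⟨q, hq⟩ := exists_walk_follows r m hrX radj ⟨a, haX⟩ ⟨c, hcX⟩ r0 rm
  have pp := hp.isPath finj
  have qp := hq.isPath rinj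
  have hsupp : ∀ v, v ∈ (p.append q.reverse).support ↔ v ∈ p.support ∨ v ∈ q.support := by
    intro v
    rw [Walk.mem_support_append_iff, Walk.support_reverse, List.mem_reverse]
  refine ⟨X, ⟨z, hzX⟩, ⟨a, haX⟩, p.append q.reverse, ?_, ?_, ?_, ?_⟩
  · refine pp.isCycle_append qp.reverse ?_ (Or.inl (by rw [hp.1]; omega))
    intro v hv hv'
    have h₁ := hp.mem_support.1 (List.mem_of_mem_tail hv)
    have h₂ := List.mem_of_mem_tail hv'
    rw [Walk.support_reverse, List.mem_reverse] at h₂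
    have h₂ := hq.mem_support.1 h₂
    have na : v ≠ ⟨a, haX⟩ := by
      rintro rfl
      have := pp.support_nodup
      rw [← Walk.cons_tail_support] at this
      exact (List.nodup_cons.1 this).1 hv
    have nc : v ≠ ⟨c, hcX⟩ := by
      rintro rfl
      have := qp.reverse.support_nodup
      rw [← Walk.cons_tail_support] at this
      exact (List.nodup_cons.1 this).1 hv'
    obtain ⟨s, hs, e⟩ := h₁
    obtain ⟨s', hs', e'⟩ := h₂
    have k1 : s ≠ 0 := by rintro rfl; exact na (Subtype.ext (e ▸ f0))
    have k2 : s ≠ n := by rintro rfl; exact nc (Subtype.ext (e ▸ fn))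
    have k3 : s' ≠ 0 := by rintro rfl; exact na (Subtype.ext (e' ▸ r0))
    have k4 : s' ≠ m := by rintro rfl; exact nc (Subtype.ext (e' ▸ rm))
    exact hne s s' (by omega) (by omega) (by omega) (by omega) (e.trans e'.symm)
  · rw [Walk.isChordless_iff_forall_mem_edges]
    -- An edge between the two paths does not join their interiors, so one of its ends is `a` or
    -- `c`. Then both ends lie on one path, which is induced.
    have key : ∀ x y : X, x ∈ p.support → y ∈ q.support → G.Adj x y →
        s(x, y) ∈ p.edges ∨ s(x, y) ∈ q.edges := by
      intro x y hx hy hxy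
      obtain ⟨s, hs, e⟩ := hp.mem_support.1 hx
      obtain ⟨s', hs', e'⟩ := hq.mem_support.1 hy
      rcases Nat.eq_zero_or_pos s with rfl | hs0
      · refine Or.inr (hq.mem_edges_of_adj rind (hq.mem_support.2 ⟨0, Nat.zero_le _, ?_⟩) hy hxy)
        rw [r0, ← e, f0]
      rcases hs.eq_or_lt with rfl | hsn
      · refine Or.inr (hq.mem_edges_of_adj rind (hq.mem_support.2 ⟨m, le_rfl, ?_⟩) hy hxy)
        rw [rm, ← e, fn]
      rcases Nat.eq_zero_or_pos s' with rfl | hs0'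
      · refine Or.inl (hp.mem_edges_of_adj find hx (hp.mem_support.2 ⟨0, Nat.zero_le _, ?_⟩) hxy)
        rw [f0, ← e', r0]
      rcases hs'.eq_or_lt with rfl | hsn'
      · refine Or.inl (hp.mem_edges_of_adj find hx (hp.mem_support.2 ⟨n, le_rfl, ?_⟩) hxy)
        rw [fn, ← e', rm]
      rw [← e, ← e'] at hxy
      exact absurd hxy (hnadj s s' hs0 hsn hs0' hsn')
    intro x y hx hy hxy
    rw [Walk.edges_append, List.mem_append, Walk.edges_reverse, List.mem_reverse]
    rcases (hsupp x).1 hx with hx | hx <;> rcases (hsupp y).1 hy with hy | hy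
    · exact Or.inl (hp.mem_edges_of_adj find hx hy hxy)
    · exact key x y hx hy hxy
    · rw [Sym2.eq_swap]
      exact key y x hy hx hxy.symm
    · exact Or.inr (hq.mem_edges_of_adj rind hx hy hxy)
  · intro v
    rw [hsupp, hp.mem_support, hq.mem_support]
    constructor
    · rintro (⟨s, hs, e⟩ | ⟨s, hs, e⟩) rfl
      · exact hzf s hs e
      · exact hzr s hs e
    · intro hv
      rcases v.2 with h | h | h
      · exact absurd (Subtype.ext h) hv
      · exact Or.inl h
      · exact Or.inr h
  · have h3 : ({⟨a, haX⟩, ⟨f t, hfX t htn.le⟩, ⟨c, hcX⟩} : Set X).ncard = 3 := by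
      rw [Set.ncard_eq_three]
      refine ⟨_, _, _, ?_, ?_, ?_, rfl⟩ <;> intro e <;> have e := congrArg Subtype.val e
      · have := finj 0 t (by omega) (by omega) (f0.trans e); omega
      · have := finj 0 n (by omega) (by omega) (f0.trans (e.trans fn.symm)); omega
      · have := finj t n (by omega) (by omega) (e.trans fn.symm); omega
    rw [← h3]
    apply Set.ncard_le_ncard _ (Set.toFinite _)
    rintro v (rfl | rfl | rfl)
    · exact ⟨(hsupp _).2 (Or.inl p.start_mem_support), hza⟩
    · exact ⟨(hsupp _).2 (Or.inl (hp.mem_support.2 ⟨t, htn.le, rfl⟩)), hzt⟩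
    · exact ⟨(hsupp _).2 (Or.inl p.end_mem_support), hzc⟩

/-! ### The three outcomes of a chord: wheel, `K₃,₃`, prism. -/

/-- `G[X]` is a prism with rungs `f i 0, …, f i (m i)`. -/
structure PrismOn (G : SimpleGraph V) (X : Set V) where
  f : Fin 3 → ℕ → V
  m : Fin 3 → ℕ
  m_pos : ∀ i, 1 ≤ m i
  inj : ∀ i j s t, s ≤ m i → t ≤ m j → f i s = f j t → i = j ∧ s = t
  adj_same : ∀ i s t, s ≤ m i → t ≤ m i → (G.Adj (f i s) (f i t) ↔ s + 1 = t ∨ t + 1 = s)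
  adj_cross : ∀ i j s t, i ≠ j → s ≤ m i → t ≤ m j →
    (G.Adj (f i s) (f j t) ↔ (s = 0 ∧ t = 0) ∨ (s = m i ∧ t = m j))
  mem_iff : ∀ v, v ∈ X ↔ ∃ i s, s ≤ m i ∧ f i s = v

/-- `G[X]` is a `K₃,₃` with sides `l` and `r`. -/
structure K33On (G : SimpleGraph V) (X : Set V) where
  l : Fin 3 → V
  r : Fin 3 → V
  l_inj : Function.Injective l
  r_inj : Function.Injective r
  ne : ∀ i j, l i ≠ r j
  adj : ∀ i j, G.Adj (l i) (r j)
  not_adj_l : ∀ i j, ¬ G.Adj (l i) (l j)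
  not_adj_r : ∀ i j, ¬ G.Adj (r i) (r j)
  mem_iff : ∀ v, v ∈ X ↔ (∃ i, l i = v) ∨ ∃ i, r i = v

namespace K4Sub

theorem p_ne (H : K4Sub G) {i j i' j' : Fin 4} (hij : i ≠ j) (hij' : i' ≠ j')
    (hne : ¬ (i = i' ∧ j = j')) (hne' : ¬ (i = j' ∧ j = i')) {s t : ℕ}
    (hs : s ≤ H.n i j) (ht : t ≤ H.n i' j')
    (h₁ : i = i' → 0 < s ∨ 0 < t) (h₂ : i = j' → 0 < s ∨ t < H.n i' j')
    (h₃ : j = i' → s < H.n i j ∨ 0 < t) (h₄ : j = j' → s < H.n i j ∨ t < H.n i' j') :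
    H.p i j s ≠ H.p i' j' t := fun e =>
  Set.disjoint_left.1 (H.disjoint_seg hij hij' hne hne' hs ht h₁ h₂ h₃ h₄)
    (apply_mem_seg le_rfl le_rfl) (e ▸ apply_mem_seg le_rfl le_rfl)

theorem exists_of_mem_verts (H : K4Sub G) {a b c d : Fin 4} (hab : a ≠ b) (hac : a ≠ c)
    (had : a ≠ d) (hbc : b ≠ c) (hbd : b ≠ d) (hcd : c ≠ d) {v : V} (hv : v ∈ H.verts) :
    ∃ s, (s ≤ H.n a b ∧ H.p a b s = v) ∨ (s ≤ H.n a c ∧ H.p a c s = v) ∨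
      (s ≤ H.n a d ∧ H.p a d s = v) ∨ (s ≤ H.n b c ∧ H.p b c s = v) ∨
      (s ≤ H.n b d ∧ H.p b d s = v) ∨ (s ≤ H.n c d ∧ H.p c d s = v) := by
  obtain ⟨i, j, s, hij, hs, rfl⟩ := hv
  have hall : ∀ x, x = a ∨ x = b ∨ x = c ∨ x = d := by
    intro x
    omega
  have hs' : H.n i j - s ≤ H.n j i := by
    rw [H.n_symm j i]
    omega
  have e : H.p j i (H.n i j - s) = H.p i j s := by
    rw [H.p_symm i j _ hij (Nat.sub_le _ _)]
    congr 1
    omega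
  rcases hall i with rfl | rfl | rfl | rfl <;> rcases hall j with rfl | rfl | rfl | rfl <;>
    first
      | exact absurd rfl hij
      | exact ⟨_, .inl ⟨hs, rfl⟩⟩
      | exact ⟨_, .inl ⟨hs', e⟩⟩
      | exact ⟨_, .inr (.inl ⟨hs, rfl⟩)⟩
      | exact ⟨_, .inr (.inl ⟨hs', e⟩)⟩
      | exact ⟨_, .inr (.inr (.inl ⟨hs, rfl⟩))⟩
      | exact ⟨_, .inr (.inr (.inl ⟨hs', e⟩))⟩
      | exact ⟨_, .inr (.inr (.inr (.inl ⟨hs, rfl⟩)))⟩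
      | exact ⟨_, .inr (.inr (.inr (.inl ⟨hs', e⟩)))⟩
      | exact ⟨_, .inr (.inr (.inr (.inr (.inl ⟨hs, rfl⟩))))⟩
      | exact ⟨_, .inr (.inr (.inr (.inr (.inl ⟨hs', e⟩))))⟩
      | exact ⟨_, .inr (.inr (.inr (.inr (.inr ⟨hs, rfl⟩))))⟩
      | exact ⟨_, .inr (.inr (.inr (.inr (.inr ⟨hs', e⟩))))⟩

variable {H : K4Sub G}

theorem Tight.adj_iff (hH : H.Tight) {i j : Fin 4} (hij : i ≠ j) {s t : ℕ} (hs : s ≤ H.n i j)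
    (ht : t ≤ H.n i j) : G.Adj (H.p i j s) (H.p i j t) ↔ s + 1 = t ∨ t + 1 = s := by
  obtain ⟨c, d, h₁, h₂, h₃, h₄, h₅⟩ : ∃ c d : Fin 4, i ≠ c ∧ i ≠ d ∧ j ≠ c ∧ j ≠ d ∧ c ≠ d := by
    clear hs ht
    revert i j
    decide
  constructor
  · intro h
    rcases lt_trichotomy s t with hst | rfl | hst
    · exact Or.inl (hH.no_chord hij h₁ h₂ h₃ h₄ h₅ hst ht h).symm
    · exact absurd h G.irrefl
    · exact Or.inr (hH.no_chord hij h₁ h₂ h₃ h₄ h₅ hst hs h.symm).symm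
  · rintro (rfl | rfl)
    · exact H.adj i j s hij (by omega)
    · exact (H.adj i j t hij (by omega)).symm

theorem p_flip (H : K4Sub G) {i j : Fin 4} (hij : i ≠ j) {s : ℕ} (hs : s ≤ H.n i j) :
    H.p j i (H.n i j - s) = H.p i j s := by
  rw [H.p_symm i j _ hij (Nat.sub_le _ _), Nat.sub_sub_self hs]

/-- A branch vertex with a neighbor inside the opposite branch path of a triangle is the hub of a
wheel. -/
theorem Tight.exists_isWheel [Finite V] (hH : H.Tight) {a b c d : Fin 4} (hab : a ≠ b) (hac : a ≠ c)
    (had : a ≠ d) (hbc : b ≠ c) (hbd : b ≠ d) (hcd : c ≠ d) {t : ℕ} (ht : 0 < t)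
    (htn : t < H.n a c) (h : G.Adj (H.b b) (H.p a c t)) : ∃ X : Set V, (G.induce X).IsWheel := by
  have nab := H.n_pos _ _ hab
  have ncb := H.n_pos _ _ hbc.symm
  have nac : H.n c a = H.n a c := H.n_symm _ _
  have h₁ : G.Adj (H.p a b (H.n a b)) (H.p a c t) := by rwa [H.p_n hab]
  have h₂ : G.Adj (H.p c b (H.n c b)) (H.p c a (H.n a c - t)) := by
    rwa [H.p_n hbc.symm, H.p_flip hac htn.le]
  -- The spoke is read as a chord starting at the last vertex of `ab`, and likewise of `cb`. Both
  -- paths are therefore single edges, so `b` is adjacent to `a` and `c`.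
  have lab := hH.eq_one_of_adj_adjacent hab hac had hbc hbd hcd nab le_rfl ht htn h₁
  have lcb := hH.eq_one_of_adj_adjacent hbc.symm hac.symm hcd hab.symm hbd had
    ncb le_rfl (by omega) (by omega) h₂
  -- The rim is closed by an induced path from `a` to `c` inside `ad ∪ cd`. Edges from its interior
  -- to the interior of `ac` are excluded by `Tight.not_adj_both`, applied at `a` or at `c` together
  -- with the spoke.
  have hA : (G.induce (seg (H.p a d) 0 (H.n a d) ∪ seg (H.p c d) 0 (H.n c d))).Connected :=
    connected_union (H.seg_connected had (by omega) le_rfl)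
      (H.seg_connected hcd (by omega) le_rfl) (H.b d) (H.b_mem_seg_right had (by omega))
      (H.b_mem_seg_right hcd (by omega))
  obtain ⟨r, m, r0, rm, rA, radj, rinj, rind⟩ := exists_induced_path hA.preconnected
    (Or.inl (H.b_mem_seg_left had)) (Or.inr (H.b_mem_seg_left hcd))
  have hr : ∀ s, 0 < s → s < m → (∃ x, 0 < x ∧ x ≤ H.n a d ∧ H.p a d x = r s) ∨
      ∃ x, 0 < x ∧ x ≤ H.n c d ∧ H.p c d x = r s := by
    intro s hs hsm
    rcases rA s hsm.le with ⟨x, hx, e⟩ | ⟨x, hx, e⟩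
    · refine Or.inl ⟨x, Nat.pos_of_ne_zero ?_, hx.2, e⟩
      rintro rfl
      rw [H.p_zero a d had, ← r0] at e
      have := rinj 0 s (by omega) (by omega) e
      omega
    · refine Or.inr ⟨x, Nat.pos_of_ne_zero ?_, hx.2, e⟩
      rintro rfl
      rw [H.p_zero c d hcd, ← rm] at e
      have := rinj m s (by omega) (by omega) e
      omega
  refine SimpleGraph.exists_isWheel (f := H.p a c) (n := H.n a c) (z := H.b b)
    (H.p_zero a c hac) (H.p_n hac) (fun s hs => H.adj a c s hac hs)
    (fun s t hs ht e => H.p_inj_same hac hs ht e)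
    (fun s t hst ht e => hH.no_chord hac hab had hbc.symm hcd hbd hst ht e) r0 rm radj rinj rind
    ?_ ?_ ?_ ?_ ?_ ?_ ht htn h
  · intro s x hs hsn hx hxm
    rcases hr x hx hxm with ⟨y, hy, hyn, e⟩ | ⟨y, hy, hyn, e⟩
    · rw [← e]
      apply H.p_ne <;> grind
    · rw [← e]
      apply H.p_ne <;> grind
  · intro s x hs hsn hx hxm hadj
    rcases hr x hx hxm with ⟨y, hy, hyn, e⟩ | ⟨y, hy, hyn, e⟩
    · rw [← e] at hadj
      exact hH.not_adj_both hab hac had hbc hbd hcd nab le_rfl ht htn h₁ hy hyn hs hsn hadj.symm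
    · rw [← e, ← H.p_flip hac hsn.le] at hadj
      exact hH.not_adj_both hbc.symm hac.symm hcd hab.symm hbd had ncb le_rfl (by omega) (by omega)
        h₂ hy hyn (by omega) (by omega) hadj.symm
  · intro s hs
    rw [← H.p_n hab]
    apply H.p_ne <;> grind
  · intro s hs
    rcases rA s hs with ⟨y, hy, e⟩ | ⟨y, hy, e⟩
    · have := hy.2
      rw [← e, ← H.p_n hab]
      apply H.p_ne <;> grind
    · have := hy.2
      rw [← e, ← H.p_n hab]
      apply H.p_ne <;> grind
  · have := H.adj_b hab
    rw [lab, H.p_zero a b hab] at this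
    exact this.symm
  · have := H.adj_b hbc.symm
    rw [lcb, H.p_zero c b hbc.symm] at this
    exact this.symm

/-- A chord between opposite branch paths yields a `K₃,₃`. -/
theorem Tight.k33On (hH : H.Tight) {a b c d : Fin 4} (hab : a ≠ b) (hac : a ≠ c)
    (had : a ≠ d) (hbc : b ≠ c) (hbd : b ≠ d) (hcd : c ≠ d) {s t : ℕ} (hs : 1 ≤ s)
    (hsn : s < H.n a b) (ht : 1 ≤ t) (htn : t < H.n c d) (h : G.Adj (H.p a b s) (H.p c d t)) :
    Nonempty (K33On G H.verts) := by
  have nba := H.n_symm b a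
  have ndc := H.n_symm d c
  have h₁ : G.Adj (H.p b a (H.n a b - s)) (H.p c d t) := by rwa [H.p_flip hab hsn.le]
  have h₂ : G.Adj (H.p a b s) (H.p d c (H.n c d - t)) := by rwa [H.p_flip hcd htn.le]
  have h₃ : G.Adj (H.p b a (H.n a b - s)) (H.p d c (H.n c d - t)) := by rwa [H.p_flip hab hsn.le]
  have lac := hH.cross_eq_one hab hac had hbc hbd hcd hs hsn ht htn h
  have lad := hH.cross_eq_one hab had hac hbd hbc hcd.symm hs hsn (by omega) (by omega) h₂
  have lbc := hH.cross_eq_one hab.symm hbc hbd hac had hcd (by omega) (by omega) ht htn h₁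
  have lbd := hH.cross_eq_one hab.symm hbd hbc had hac hcd.symm (by omega) (by omega) (by omega)
    (by omega) h₃
  have es := hH.opposite_eq_one hab hac had hbc hbd hcd hs hsn ht htn h
  have es' := hH.opposite_eq_one hab.symm hbc hbd hac had hcd (by omega) (by omega) ht htn h₁
  have et := hH.opposite_eq_one hcd hac.symm hbc.symm had.symm hbd.symm hab ht htn hs hsn h.symm
  have et' := hH.opposite_eq_one hcd.symm had.symm hbd.symm hac.symm hbc.symm hab
    (by omega) (by omega) hs hsn h₂.symm
  -- Each end of the chord is next to both ends of its branch path, hence is its middle vertex.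
  have lab : H.n a b = 2 := by omega
  have lcd : H.n c d = 2 := by omega
  subst es et
  have e0 : ∀ i j, i ≠ j → H.n i j = 1 → G.Adj (H.b i) (H.b j) := by
    intro i j hij e
    have := H.adj_b hij
    rwa [e, H.p_zero i j hij] at this
  have e1 : ∀ i j, i ≠ j → H.n i j = 2 → ¬ G.Adj (H.b i) (H.b j) := by
    intro i j hij e h
    rw [← H.p_zero i j hij, ← H.p_n hij, hH.adj_iff hij (by omega) le_rfl] at h
    omega
  -- A further edge at the middle of `cd` would make `ab` a single edge, but its length is two.
  have a_v : ¬ G.Adj (H.b a) (H.p c d 1) := fun h => by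
    have := hH.far_eq_one hab hac had hbc hbd hcd le_rfl htn h
    omega
  have b_v : ¬ G.Adj (H.b b) (H.p c d 1) := fun h => by
    have := hH.far_eq_one hab.symm hbc hbd hac had hcd le_rfl htn h
    omega
  have c_u : ¬ G.Adj (H.b c) (H.p a b 1) := fun h => by
    have := hH.far_eq_one hcd hac.symm hbc.symm had.symm hbd.symm hab le_rfl hsn h
    omega
  have d_u : ¬ G.Adj (H.b d) (H.p a b 1) := fun h => by
    have := hH.far_eq_one hcd.symm had.symm hbd.symm hac.symm hbc.symm hab le_rfl hsn h
    omega
  have na_b := e1 a b hab lab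
  have nc_d := e1 c d hcd lcd
  have a_c := e0 a c hac lac
  have a_d := e0 a d had lad
  have b_c := e0 b c hbc lbc
  have b_d := e0 b d hbd lbd
  have a_u := H.adj_b_left hab
  have c_v := H.adj_b_left hcd
  have u_b : G.Adj (H.p a b 1) (H.b b) := by simpa [lab] using H.adj_b hab
  have v_d : G.Adj (H.p c d 1) (H.b d) := by simpa [lcd] using H.adj_b hcd
  have ua : ∀ k, H.p a b 1 ≠ H.b k := fun k => H.p_ne_b a b 1 k hab (by omega) (by omega)
  have vc : ∀ k, H.p c d 1 ≠ H.b k := fun k => H.p_ne_b c d 1 k hcd (by omega) (by omega)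
  have bne : ∀ i j, i ≠ j → H.b i ≠ H.b j := fun i j hij e => hij (H.b_inj e)
  have hmem : ∀ v, v ∈ H.verts ↔ (∃ i, ![H.b a, H.b b, H.p c d 1] i = v) ∨
      ∃ i, ![H.b c, H.b d, H.p a b 1] i = v := by
    intro v
    constructor
    · intro hv
      have hcase : ∀ x ≤ 2, x = 0 ∨ x = 1 ∨ x = 2 := by omega
      have hcase' : ∀ x ≤ 1, x = 0 ∨ x = 1 := by omega
      have pn : ∀ i j k, i ≠ j → H.n i j = k → H.p i j k = H.b j := by
        rintro i j _ hij rfl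
        exact H.p_n hij
      obtain ⟨x, ⟨hx, rfl⟩ | ⟨hx, rfl⟩ | ⟨hx, rfl⟩ | ⟨hx, rfl⟩ | ⟨hx, rfl⟩ | ⟨hx, rfl⟩⟩ :=
        H.exists_of_mem_verts hab hac had hbc hbd hcd hv
      · rw [lab] at hx
        rcases hcase x hx with rfl | rfl | rfl
        · exact Or.inl ⟨0, (H.p_zero a b hab).symm⟩
        · exact Or.inr ⟨2, rfl⟩
        · exact Or.inl ⟨1, (pn a b 2 hab lab).symm⟩
      · rw [lac] at hx
        rcases hcase' x hx with rfl | rfl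
        · exact Or.inl ⟨0, (H.p_zero a c hac).symm⟩
        · exact Or.inr ⟨0, (pn a c 1 hac lac).symm⟩
      · rw [lad] at hx
        rcases hcase' x hx with rfl | rfl
        · exact Or.inl ⟨0, (H.p_zero a d had).symm⟩
        · exact Or.inr ⟨1, (pn a d 1 had lad).symm⟩
      · rw [lbc] at hx
        rcases hcase' x hx with rfl | rfl
        · exact Or.inl ⟨1, (H.p_zero b c hbc).symm⟩
        · exact Or.inr ⟨0, (pn b c 1 hbc lbc).symm⟩
      · rw [lbd] at hx
        rcases hcase' x hx with rfl | rfl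
        · exact Or.inl ⟨1, (H.p_zero b d hbd).symm⟩
        · exact Or.inr ⟨1, (pn b d 1 hbd lbd).symm⟩
      · rw [lcd] at hx
        rcases hcase x hx with rfl | rfl | rfl
        · exact Or.inr ⟨0, (H.p_zero c d hcd).symm⟩
        · exact Or.inl ⟨2, rfl⟩
        · exact Or.inr ⟨1, (pn c d 2 hcd lcd).symm⟩
    · rintro (⟨i, rfl⟩ | ⟨i, rfl⟩) <;> fin_cases i
      · exact H.b_mem_verts a
      · exact H.b_mem_verts b
      · exact ⟨c, d, 1, hcd, htn.le, rfl⟩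
      · exact H.b_mem_verts c
      · exact H.b_mem_verts d
      · exact ⟨a, b, 1, hab, hsn.le, rfl⟩
  have uv : H.p a b 1 ≠ H.p c d 1 := h.ne
  refine ⟨⟨![H.b a, H.b b, H.p c d 1], ![H.b c, H.b d, H.p a b 1], ?_, ?_, ?_, ?_, ?_, ?_, hmem⟩⟩
  · intro i j e
    fin_cases i <;> fin_cases j <;> first
      | rfl
      | exact absurd e (bne a b hab)
      | exact absurd e.symm (bne a b hab)
      | exact absurd e (vc _)
      | exact absurd e.symm (vc _)
  · intro i j e
    fin_cases i <;> fin_cases j <;> first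
      | rfl
      | exact absurd e (bne c d hcd)
      | exact absurd e.symm (bne c d hcd)
      | exact absurd e (ua _)
      | exact absurd e.symm (ua _)
  · intro i j
    fin_cases i <;> fin_cases j
    · exact bne a c hac
    · exact bne a d had
    · exact (ua a).symm
    · exact bne b c hbc
    · exact bne b d hbd
    · exact (ua b).symm
    · exact vc c
    · exact vc d
    · exact uv.symm
  · intro i j
    fin_cases i <;> fin_cases j
    · exact a_c
    · exact a_d
    · exact a_u
    · exact b_c
    · exact b_d
    · exact u_b.symm
    · exact c_v.symm
    · exact v_d
    · exact h.symm
  · intro i j h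
    fin_cases i <;> fin_cases j <;> first
      | exact G.irrefl h
      | exact na_b h
      | exact na_b h.symm
      | exact a_v h
      | exact a_v h.symm
      | exact b_v h
      | exact b_v h.symm
  · intro i j h
    fin_cases i <;> fin_cases j <;> first
      | exact G.irrefl h
      | exact nc_d h
      | exact nc_d h.symm
      | exact c_u h
      | exact c_u h.symm
      | exact d_u h
      | exact d_u h.symm

theorem adj_b_b (H : K4Sub G) {i j : Fin 4} (hij : i ≠ j) (h : H.n i j = 1) :
    G.Adj (H.b i) (H.b j) := by
  have := H.adj_b hij
  rwa [h, H.p_zero i j hij] at this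

/-- No branch vertex has a neighbor inside a branch path that does not end there. -/
def NoSpoke (H : K4Sub G) : Prop :=
  ∀ i j k t, i ≠ j → i ≠ k → j ≠ k → 0 < t → t < H.n j k → ¬ G.Adj (H.b i) (H.p j k t)

/-- In the prism, the rung on `ab` starts at index 1, since `a` belongs to the rung `ad`. Further
edges to `ad` are spokes or join interiors; the latter are impossible because the interior of `ab`
already has a neighbor on `ac`. -/
theorem Tight.adj_rung_iff (hH : H.Tight) (hB : H.NoSpoke) {a b c d : Fin 4} (hab : a ≠ b)
    (hac : a ≠ c) (had : a ≠ d) (hbc : b ≠ c) (hbd : b ≠ d) (hcd : c ≠ d)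
    (hb : 2 ≤ H.n a b) (hc : 2 ≤ H.n a c) (h : G.Adj (H.p a b 1) (H.p a c 1))
    (lbd : H.n b d = 1) {s t : ℕ} (hs : 1 ≤ s) (hsn : s ≤ H.n a b) (htn : t ≤ H.n a d) :
    G.Adj (H.p a b s) (H.p a d t) ↔ (s = 1 ∧ t = 0) ∨ (s = H.n a b ∧ t = H.n a d) := by
  constructor
  · intro hadj
    rcases Nat.eq_zero_or_pos t with rfl | ht
    · rw [H.p_zero a d had, ← H.p_zero a b hab, hH.adj_iff hab hsn (Nat.zero_le _)] at hadj
      exact Or.inl ⟨by omega, rfl⟩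
    rcases hsn.eq_or_lt with rfl | hsn'
    · rcases htn.eq_or_lt with rfl | htn'
      · exact Or.inr ⟨rfl, rfl⟩
      · rw [H.p_n hab] at hadj
        exact absurd hadj (hB b a d t hab.symm hbd had ht htn')
    · rcases htn.eq_or_lt with rfl | htn'
      · rw [H.p_n had] at hadj
        exact absurd hadj.symm (hB d a b s had.symm hbd.symm hab hs hsn')
      · exact (hH.not_adj_both hac hab had hbc.symm hcd hbd le_rfl (by omega) le_rfl (by omega)
          h.symm ht htn hs hsn' hadj.symm).elim
  · rintro (⟨rfl, rfl⟩ | ⟨rfl, rfl⟩)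
    · rw [H.p_zero a d had]
      exact (H.adj_b_left hab).symm
    · rw [H.p_n hab, H.p_n had]
      exact H.adj_b_b hbd lbd

/-- A chord between two branch paths with a common end yields a prism. -/
theorem Tight.prismOn (hH : H.Tight) (hB : H.NoSpoke) {a b c d : Fin 4} (hab : a ≠ b)
    (hac : a ≠ c) (had : a ≠ d) (hbc : b ≠ c) (hbd : b ≠ d) (hcd : c ≠ d) {s t : ℕ}
    (hs : 1 ≤ s) (hsn : s < H.n a b) (ht : 1 ≤ t) (htn : t < H.n a c)
    (h : G.Adj (H.p a b s) (H.p a c t)) : Nonempty (PrismOn G H.verts) := by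
  have es := hH.eq_one_of_adj_adjacent hab hac had hbc hbd hcd hs hsn.le ht htn h
  have et := hH.eq_one_of_adj_adjacent hac hab had hbc.symm hcd hbd ht htn.le hs hsn h.symm
  subst es et
  have nad := H.n_pos _ _ had
  have lbc := hH.opposite_side_eq_one hab hac had hbc hbd hcd hsn htn h
  have lbd := hH.other_side_eq_one hab hac had hbc hbd hcd hsn htn h
  have lcd := hH.other_side_eq_one hac hab had hbc.symm hcd hbd htn hsn h.symm
  have k01 : ∀ s t, 1 ≤ s → s ≤ H.n a b → 1 ≤ t → t ≤ H.n a c →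
      (G.Adj (H.p a b s) (H.p a c t) ↔ (s = 1 ∧ t = 1) ∨ (s = H.n a b ∧ t = H.n a c)) := by
    intro s t hs hsn ht htn
    constructor
    · intro hadj
      rcases hsn.eq_or_lt with rfl | hsn'
      · rcases htn.eq_or_lt with rfl | htn'
        · exact Or.inr ⟨rfl, rfl⟩
        · rw [H.p_n hab] at hadj
          exact absurd hadj (hB b a c t hab.symm hbc hac ht htn')
      · rcases htn.eq_or_lt with rfl | htn'
        · rw [H.p_n hac] at hadj
          exact absurd hadj.symm (hB c a b s hac.symm hbc.symm hab hs hsn')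
        · exact Or.inl ⟨hH.eq_one_of_adj_adjacent hab hac had hbc hbd hcd hs hsn ht htn' hadj,
            hH.eq_one_of_adj_adjacent hac hab had hbc.symm hcd hbd ht htn hs hsn' hadj.symm⟩
    · rintro (⟨rfl, rfl⟩ | ⟨rfl, rfl⟩)
      · exact h
      · rw [H.p_n hab, H.p_n hac]
        exact H.adj_b_b hbc lbc
  have k02 : ∀ s t, 1 ≤ s → s ≤ H.n a b → t ≤ H.n a d →
      (G.Adj (H.p a b s) (H.p a d t) ↔ (s = 1 ∧ t = 0) ∨ (s = H.n a b ∧ t = H.n a d)) :=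
    fun s t => hH.adj_rung_iff hB hab hac had hbc hbd hcd hsn htn h lbd
  have k12 : ∀ s t, 1 ≤ s → s ≤ H.n a c → t ≤ H.n a d →
      (G.Adj (H.p a c s) (H.p a d t) ↔ (s = 1 ∧ t = 0) ∨ (s = H.n a c ∧ t = H.n a d)) :=
    fun s t => hH.adj_rung_iff hB hac hab had hbc.symm hcd hbd htn hsn h.symm lcd
  have d01 : ∀ s t, 1 ≤ s → s ≤ H.n a b → 1 ≤ t → t ≤ H.n a c → H.p a b s ≠ H.p a c t := by
    intro s t hs hsn ht htn
    apply H.p_ne <;> grind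
  have d02 : ∀ s t, 1 ≤ s → s ≤ H.n a b → t ≤ H.n a d → H.p a b s ≠ H.p a d t := by
    intro s t hs hsn htn
    apply H.p_ne <;> grind
  have d12 : ∀ s t, 1 ≤ s → s ≤ H.n a c → t ≤ H.n a d → H.p a c s ≠ H.p a d t := by
    intro s t hs hsn htn
    apply H.p_ne <;> grind
  -- One triangle consists of `a` and its neighbors on `ab` and `ac`, the other of `b`, `c` and `d`,
  -- which are pairwise joined by single edges.
  let f : Fin 3 → ℕ → V := ![fun s => H.p a b (s + 1), fun s => H.p a c (s + 1), H.p a d]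
  let m : Fin 3 → ℕ := ![H.n a b - 1, H.n a c - 1, H.n a d]
  have inj01 : ∀ i j s t, i < j → s ≤ m i → t ≤ m j → f i s ≠ f j t := by
    intro i j s t hij hs ht
    fin_cases i <;> fin_cases j <;> first | exact absurd hij (by decide) | skip
    · exact d01 _ _ (by omega) (by change s ≤ H.n a b - 1 at hs; omega) (by omega)
        (by change t ≤ H.n a c - 1 at ht; omega)
    · exact d02 _ _ (by omega) (by change s ≤ H.n a b - 1 at hs; omega) ht
    · exact d12 _ _ (by omega) (by change s ≤ H.n a c - 1 at hs; omega) ht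
  have cross : ∀ i j s t, i < j → s ≤ m i → t ≤ m j →
      (G.Adj (f i s) (f j t) ↔ (s = 0 ∧ t = 0) ∨ (s = m i ∧ t = m j)) := by
    intro i j s t hij hs ht
    fin_cases i <;> fin_cases j <;> first | exact absurd hij (by decide) | skip
    · change s ≤ H.n a b - 1 at hs
      change t ≤ H.n a c - 1 at ht
      change G.Adj (H.p a b (s + 1)) (H.p a c (t + 1)) ↔
        (s = 0 ∧ t = 0) ∨ (s = H.n a b - 1 ∧ t = H.n a c - 1)
      rw [k01 _ _ (by omega) (by omega) (by omega) (by omega)]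
      omega
    · change s ≤ H.n a b - 1 at hs
      change t ≤ H.n a d at ht
      change G.Adj (H.p a b (s + 1)) (H.p a d t) ↔
        (s = 0 ∧ t = 0) ∨ (s = H.n a b - 1 ∧ t = H.n a d)
      rw [k02 _ _ (by omega) (by omega) (by omega)]
      omega
    · change s ≤ H.n a c - 1 at hs
      change t ≤ H.n a d at ht
      change G.Adj (H.p a c (s + 1)) (H.p a d t) ↔
        (s = 0 ∧ t = 0) ∨ (s = H.n a c - 1 ∧ t = H.n a d)
      rw [k12 _ _ (by omega) (by omega) (by omega)]
      omega
  refine ⟨⟨f, m, ?_, ?_, ?_, ?_, ?_⟩⟩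
  · intro i
    fin_cases i
    · change 1 ≤ H.n a b - 1
      omega
    · change 1 ≤ H.n a c - 1
      omega
    · exact nad
  · intro i j s t hs ht e
    rcases lt_trichotomy i j with hij | rfl | hij
    · exact absurd e (inj01 i j s t hij hs ht)
    · refine ⟨rfl, ?_⟩
      fin_cases i
      · change s ≤ H.n a b - 1 at hs
        change t ≤ H.n a b - 1 at ht
        have := H.p_inj_same hab (by omega) (by omega) e
        omega
      · change s ≤ H.n a c - 1 at hs
        change t ≤ H.n a c - 1 at ht
        have := H.p_inj_same hac (by omega) (by omega) e
        omega
      · exact H.p_inj_same had hs ht e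
    · exact absurd e.symm (inj01 j i t s hij ht hs)
  · intro i s t hs ht
    fin_cases i
    · change s ≤ H.n a b - 1 at hs
      change t ≤ H.n a b - 1 at ht
      refine (hH.adj_iff hab (by omega) (by omega)).trans ?_
      omega
    · change s ≤ H.n a c - 1 at hs
      change t ≤ H.n a c - 1 at ht
      refine (hH.adj_iff hac (by omega) (by omega)).trans ?_
      omega
    · exact hH.adj_iff had hs ht
  · intro i j s t hij hs ht
    rcases lt_or_gt_of_ne hij with hij | hij
    · exact cross i j s t hij hs ht
    · rw [G.adj_comm, cross j i t s hij ht hs]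
      tauto
  · intro v
    have fb : ∃ s ≤ m 0, f 0 s = H.b b := ⟨H.n a b - 1, le_rfl, by
      change H.p a b (H.n a b - 1 + 1) = _
      rw [Nat.sub_add_cancel (by omega), H.p_n hab]⟩
    have fc : ∃ s ≤ m 1, f 1 s = H.b c := ⟨H.n a c - 1, le_rfl, by
      change H.p a c (H.n a c - 1 + 1) = _
      rw [Nat.sub_add_cancel (by omega), H.p_n hac]⟩
    have fd : ∃ s ≤ m 2, f 2 s = H.b d := ⟨H.n a d, le_rfl, H.p_n had⟩
    have fa : ∃ s ≤ m 2, f 2 s = H.b a := ⟨0, Nat.zero_le _, H.p_zero a d had⟩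
    have short : ∀ i j x, i ≠ j → H.n i j = 1 → x ≤ H.n i j →
        H.p i j x = H.b i ∨ H.p i j x = H.b j := by
      intro i j x hij hn hx
      rcases Nat.eq_zero_or_pos x with rfl | h0
      · exact Or.inl (H.p_zero i j hij)
      · rw [← H.p_n hij]
        exact Or.inr (by congr 1; omega)
    constructor
    · intro hv
      obtain ⟨x, ⟨hx, rfl⟩ | ⟨hx, rfl⟩ | ⟨hx, rfl⟩ | ⟨hx, rfl⟩ | ⟨hx, rfl⟩ | ⟨hx, rfl⟩⟩ :=
        H.exists_of_mem_verts hab hac had hbc hbd hcd hv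
      · rcases x with _ | x
        · rw [H.p_zero a b hab]
          exact ⟨2, fa⟩
        · exact ⟨0, x, by change x ≤ H.n a b - 1; omega, rfl⟩
      · rcases x with _ | x
        · rw [H.p_zero a c hac]
          exact ⟨2, fa⟩
        · exact ⟨1, x, by change x ≤ H.n a c - 1; omega, rfl⟩
      · exact ⟨2, x, hx, rfl⟩
      · rcases short b c x hbc lbc hx with e | e <;> rw [e]
        exacts [⟨0, fb⟩, ⟨1, fc⟩]
      · rcases short b d x hbd lbd hx with e | e <;> rw [e]
        exacts [⟨0, fb⟩, ⟨2, fd⟩]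
      · rcases short c d x hcd lcd hx with e | e <;> rw [e]
        exacts [⟨1, fc⟩, ⟨2, fd⟩]
    · rintro ⟨i, s, hs, rfl⟩
      fin_cases i
      · exact ⟨a, b, s + 1, hab, by change s ≤ H.n a b - 1 at hs; omega, rfl⟩
      · exact ⟨a, c, s + 1, hac, by change s ≤ H.n a c - 1 at hs; omega, rfl⟩
      · exact ⟨a, d, s, had, hs, rfl⟩

theorem Tight.prismOn_or_k33On [Finite V] (hH : H.Tight) (hI : G.IsISK4Free)
    (hW : G.IsWheelFree) : Nonempty (PrismOn G H.verts) ∨ Nonempty (K33On G H.verts) := by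
  have hB : H.NoSpoke := by
    intro i j k t hij hik hjk ht htn h
    obtain ⟨l, h₁, h₂, h₃⟩ : ∃ l : Fin 4, j ≠ l ∧ i ≠ l ∧ k ≠ l := by
      clear h htn
      revert i j k
      decide
    obtain ⟨X, hX⟩ := hH.exists_isWheel hij.symm hjk h₁ hik h₂ h₃ ht htn h
    exact hW X hX
  by_contra hcon
  rw [not_or] at hcon
  obtain ⟨hP, hK⟩ := hcon
  refine hI H.verts (H.isSubdivisionOf ?_)
  have hsame : ∀ i j s t, i ≠ j → s ≤ H.n i j → t ≤ H.n i j → G.Adj (H.p i j s) (H.p i j t) →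
      ∃ i' j' s', i' ≠ j' ∧ s' < H.n i' j' ∧
        s(H.p i j s, H.p i j t) = s(H.p i' j' s', H.p i' j' (s' + 1)) := by
    intro i j s t hij hs ht h
    rcases (hH.adj_iff hij hs ht).1 h with rfl | rfl
    · exact ⟨i, j, s, hij, by omega, rfl⟩
    · exact ⟨i, j, t, hij, by omega, Sym2.eq_swap⟩
  -- Since there are no spokes, an edge at a branch vertex has both ends on one branch path through
  -- that vertex.
  have hbr : ∀ k i j s, i ≠ j → s ≤ H.n i j → G.Adj (H.b k) (H.p i j s) →
      ∃ i' j' s', i' ≠ j' ∧ s' < H.n i' j' ∧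
        s(H.b k, H.p i j s) = s(H.p i' j' s', H.p i' j' (s' + 1)) := by
    intro k i j s hij hs h
    by_cases hki : k = i
    · subst hki
      rw [← H.p_zero k j hij] at h ⊢
      exact hsame k j 0 s hij (Nat.zero_le _) hs h
    by_cases hkj : k = j
    · subst hkj
      rw [← H.p_n hij] at h ⊢
      exact hsame i k _ s hij le_rfl hs h
    rcases Nat.eq_zero_or_pos s with rfl | hs0
    · rw [H.p_zero i j hij, ← H.p_zero k i hki, ← H.p_n hki] at h
      rw [H.p_zero i j hij, ← H.p_zero k i hki, ← H.p_n hki]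
      exact hsame k i _ _ hki (Nat.zero_le _) le_rfl h
    rcases hs.eq_or_lt with rfl | hsn
    · rw [H.p_n hij, ← H.p_zero k j hkj, ← H.p_n hkj] at h
      rw [H.p_n hij, ← H.p_zero k j hkj, ← H.p_n hkj]
      exact hsame k j _ _ hkj (Nat.zero_le _) le_rfl h
    exact absurd h (hB k i j s hki hkj hij hs0 hsn)
  rintro _ ⟨i, j, s, hij, hs, rfl⟩ _ ⟨i', j', t, hij', ht, rfl⟩ h
  rcases Nat.eq_zero_or_pos s with rfl | hs0
  · rw [H.p_zero i j hij] at h ⊢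
    exact hbr i i' j' t hij' ht h
  rcases hs.eq_or_lt with rfl | hsn
  · rw [H.p_n hij] at h ⊢
    exact hbr j i' j' t hij' ht h
  rcases Nat.eq_zero_or_pos t with rfl | ht0
  · rw [H.p_zero i' j' hij'] at h ⊢
    rw [Sym2.eq_swap]
    exact hbr i' i j s hij hs h.symm
  rcases ht.eq_or_lt with rfl | htn
  · rw [H.p_n hij'] at h ⊢
    rw [Sym2.eq_swap]
    exact hbr j' i j s hij hs h.symm
  -- From here on both ends of the edge are interior to branch paths. Paths with a common end are
  -- oriented away from it so that `hA` applies.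
  have third : ∀ a b c : Fin 4, ∃ d, a ≠ d ∧ b ≠ d ∧ c ≠ d := by decide
  have hA : ∀ a b c s t, a ≠ b → a ≠ c → b ≠ c → 1 ≤ s → s < H.n a b → 1 ≤ t → t < H.n a c →
      ¬ G.Adj (H.p a b s) (H.p a c t) := by
    intro a b c s t hab hac hbc hs hsn ht htn h
    obtain ⟨d, h₁, h₂, h₃⟩ := third a b c
    exact hP (hH.prismOn hB hab hac h₁ hbc h₂ h₃ hs hsn ht htn h)
  have nij := H.n_symm j i
  have nij' := H.n_symm j' i'
  by_cases h₁ : i = i'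
  · subst h₁
    by_cases h₂ : j = j'
    · subst h₂
      exact hsame i j s t hij hs ht h
    · exact absurd h (hA i j j' s t hij hij' h₂ hs0 hsn ht0 htn)
  by_cases h₂ : j = j'
  · subst h₂
    rw [← H.p_flip hij hs, ← H.p_flip hij' ht] at h
    exact absurd h (hA _ _ _ _ _ hij.symm hij'.symm h₁ (by omega) (by omega) (by omega) (by omega))
  by_cases h₃ : i = j'
  · subst h₃
    rw [← H.p_flip hij' ht] at h ⊢
    by_cases h₄ : j = i'
    · subst h₄
      exact hsame i j s _ hij hs (by omega) h
    · exact absurd h (hA _ _ _ _ _ hij hij'.symm h₄ hs0 hsn (by omega) (by omega))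
  by_cases h₄ : j = i'
  · subst h₄
    rw [← H.p_flip hij hs] at h
    exact absurd h (hA _ _ _ _ _ hij.symm hij' h₃ (by omega) (by omega) ht0 htn)
  exact absurd (hH.k33On hij h₁ h₃ h₄ h₂ hij' hs0 hsn ht0 htn h) hK

end K4Sub

/-- Minimality is used twice: the subdivision inside `X` covers `X`, and it is tight. -/
theorem prismOn_or_k33On [Finite V] {X : Set V} (hX : Minimal G.HasK4Minor X)
    (hI : G.IsISK4Free) (hW : G.IsWheelFree) : Nonempty (PrismOn G X) ∨ Nonempty (K33On G X) := by
  obtain ⟨H, hH⟩ := hX.prop.exists_k4Sub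
  have e : H.verts = X := hX.eq_of_subset H.hasK4Minor_verts hH
  subst e
  refine K4Sub.Tight.prismOn_or_k33On ?_ hI hW
  intro i j s hij hs Y hY hd hm
  have := hX.eq_of_subset hm hY
  subst this
  exact Set.disjoint_left.1 hd ⟨i, j, s, hij, hs, rfl⟩ (apply_mem_seg le_rfl le_rfl)

/-! ### Degrees in the two shapes, and the effect of deleting an edge. -/

/-- The neighbors of `v` in `X`. -/
def nbrs (G : SimpleGraph V) (X : Set V) (v : V) : Set V := {u | u ∈ X ∧ G.Adj v u}

/-- The vertices of degree at least three in `G[X]`. -/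
def branchSet (G : SimpleGraph V) (X : Set V) : Set V := {v | v ∈ X ∧ 3 ≤ (G.nbrs X v).ncard}

theorem ncard_triple {a b c : V} (hab : a ≠ b) (hac : a ≠ c) (hbc : b ≠ c) :
    ({a, b, c} : Set V).ncard = 3 :=
  Set.ncard_eq_three.2 ⟨a, b, c, hab, hac, hbc, rfl⟩

namespace PrismOn

variable {X : Set V} (P : PrismOn G X)

theorem mem {i : Fin 3} {s : ℕ} (hs : s ≤ P.m i) : P.f i s ∈ X := (P.mem_iff _).2 ⟨i, s, hs, rfl⟩

/-- The prism with its two triangles exchanged. -/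
def flip : PrismOn G X where
  f i s := P.f i (P.m i - s)
  m := P.m
  m_pos := P.m_pos
  inj i j s t hs ht e := by
    obtain ⟨rfl, h⟩ := P.inj i j _ _ (Nat.sub_le _ _) (Nat.sub_le _ _) e
    exact ⟨rfl, by omega⟩
  adj_same i s t hs ht := by
    rw [P.adj_same i _ _ (Nat.sub_le _ _) (Nat.sub_le _ _)]
    omega
  adj_cross i j s t hij hs ht := by
    rw [P.adj_cross i j _ _ hij (Nat.sub_le _ _) (Nat.sub_le _ _)]
    omega
  mem_iff v := by
    rw [P.mem_iff]
    constructor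
    · rintro ⟨i, s, hs, rfl⟩
      exact ⟨i, P.m i - s, Nat.sub_le _ _, by rw [Nat.sub_sub_self hs]⟩
    · rintro ⟨i, s, hs, rfl⟩
      exact ⟨i, P.m i - s, Nat.sub_le _ _, rfl⟩

theorem nbrs_zero (i : Fin 3) : (G.nbrs X (P.f i 0)).ncard = 3 := by
  obtain ⟨j, k, hij, hik, hjk, hall⟩ : ∃ j k : Fin 3, i ≠ j ∧ i ≠ k ∧ j ≠ k ∧
      ∀ x, x = i ∨ x = j ∨ x = k := by
    revert i
    decide
  have h0 := P.m_pos i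
  have : G.nbrs X (P.f i 0) = {P.f i 1, P.f j 0, P.f k 0} := by
    ext v
    constructor
    · rintro ⟨hv, h⟩
      obtain ⟨x, s, hs, rfl⟩ := (P.mem_iff v).1 hv
      rcases hall x with rfl | rfl | rfl
      · rw [P.adj_same _ _ _ (Nat.zero_le _) hs] at h
        obtain rfl : s = 1 := by omega
        exact Or.inl rfl
      · rw [P.adj_cross _ _ _ _ hij (Nat.zero_le _) hs] at h
        obtain rfl : s = 0 := by omega
        exact Or.inr (Or.inl rfl)
      · rw [P.adj_cross _ _ _ _ hik (Nat.zero_le _) hs] at h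
        obtain rfl : s = 0 := by omega
        exact Or.inr (Or.inr rfl)
    · rintro (rfl | rfl | rfl)
      · exact ⟨P.mem h0, (P.adj_same _ _ _ (Nat.zero_le _) h0).2 (Or.inl rfl)⟩
      · exact ⟨P.mem (Nat.zero_le _),
          (P.adj_cross _ _ _ _ hij (Nat.zero_le _) (Nat.zero_le _)).2 (Or.inl ⟨rfl, rfl⟩)⟩
      · exact ⟨P.mem (Nat.zero_le _),
          (P.adj_cross _ _ _ _ hik (Nat.zero_le _) (Nat.zero_le _)).2 (Or.inl ⟨rfl, rfl⟩)⟩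
  rw [this]
  refine ncard_triple (fun e => ?_) (fun e => ?_) fun e => ?_
  · exact hij (P.inj _ _ _ _ h0 (Nat.zero_le _) e).1
  · exact hik (P.inj _ _ _ _ h0 (Nat.zero_le _) e).1
  · exact hjk (P.inj _ _ _ _ (Nat.zero_le _) (Nat.zero_le _) e).1

theorem nbrs_last (i : Fin 3) : (G.nbrs X (P.f i (P.m i))).ncard = 3 :=
  P.flip.nbrs_zero i

theorem nbrs_interior (i : Fin 3) {s : ℕ} (hs : 0 < s) (hsm : s < P.m i) :
    (G.nbrs X (P.f i s)).ncard ≤ 2 := by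
  have : G.nbrs X (P.f i s) ⊆ {P.f i (s - 1), P.f i (s + 1)} := by
    rintro v ⟨hv, h⟩
    obtain ⟨x, t, ht, rfl⟩ := (P.mem_iff v).1 hv
    by_cases hx : i = x
    · subst hx
      rw [P.adj_same _ _ _ hsm.le ht] at h
      rcases h with rfl | rfl
      · exact Or.inr rfl
      · exact Or.inl rfl
    · rw [P.adj_cross _ _ _ _ hx hsm.le ht] at h
      omega
  exact (Set.ncard_le_ncard this).trans ((Set.ncard_insert_le _ _).trans (by simp))

/-- The six vertices of the two triangles. -/
def corner (x : Fin 3 × Bool) : V := P.f x.1 (if x.2 then P.m x.1 else 0)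

theorem corner_injective : Function.Injective P.corner := by
  rintro ⟨i, b⟩ ⟨j, b'⟩ e
  have h1 : (if b then P.m i else 0) ≤ P.m i := by split_ifs <;> omega
  have h2 : (if b' then P.m j else 0) ≤ P.m j := by split_ifs <;> omega
  obtain ⟨rfl, e⟩ := P.inj _ _ _ _ h1 h2 e
  have := P.m_pos i
  cases b <;> cases b' <;> simp at e ⊢ <;> omega

theorem branchSet_eq : G.branchSet X = Set.range P.corner := by
  ext v
  constructor
  · rintro ⟨hv, h⟩
    obtain ⟨i, s, hs, rfl⟩ := (P.mem_iff v).1 hv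
    rcases Nat.eq_zero_or_pos s with rfl | hs0
    · exact ⟨(i, false), rfl⟩
    rcases hs.eq_or_lt with rfl | hsm
    · exact ⟨(i, true), rfl⟩
    · have := P.nbrs_interior i hs0 hsm
      omega
  · rintro ⟨⟨i, b⟩, rfl⟩
    cases b
    · exact ⟨P.mem (Nat.zero_le _), (P.nbrs_zero i).ge⟩
    · exact ⟨P.mem le_rfl, (P.nbrs_last i).ge⟩

theorem ncard_branchSet (P : PrismOn G X) : (G.branchSet X).ncard = 6 := by
  rw [P.branchSet_eq, ← Nat.card_coe_set_eq, Nat.card_range_of_injective P.corner_injective]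
  simp

theorem nbrs_le (P : PrismOn G X) {v : V} (hv : v ∈ X) : (G.nbrs X v).ncard ≤ 3 := by
  obtain ⟨i, s, hs, rfl⟩ := (P.mem_iff v).1 hv
  rcases Nat.eq_zero_or_pos s with rfl | hs0
  · exact (P.nbrs_zero i).le
  rcases hs.eq_or_lt with rfl | hsm
  · exact (P.nbrs_last i).le
  · exact (P.nbrs_interior i hs0 hsm).trans (by omega)

/-- Rungs `i` and `j` are contracted to bags, which still touch in the other triangle; the third
rung is split into its first vertex and the rest. -/
theorem hasK4Minor_deleteEdges {i j : Fin 3} (hij : i ≠ j) :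
    (G.deleteEdges {s(P.f i 0, P.f j 0)}).HasK4Minor X := by
  obtain ⟨k, hik, hjk⟩ : ∃ k : Fin 3, i ≠ k ∧ j ≠ k := by
    revert i j
    decide
  have mi := P.m_pos i
  have mj := P.m_pos j
  have mk := P.m_pos k
  have hsub : ∀ x s t, t ≤ P.m x → seg (P.f x) s t ⊆ X := by
    rintro x s t ht _ ⟨r, hr, rfl⟩
    exact P.mem (hr.2.trans ht)
  have hadj : ∀ x y s t, s ≤ P.m x → t ≤ P.m y → G.Adj (P.f x s) (P.f y t) →
      ¬ (x = i ∧ y = j ∧ s = 0 ∧ t = 0) → ¬ (x = j ∧ y = i ∧ s = 0 ∧ t = 0) →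
      (G.deleteEdges {s(P.f i 0, P.f j 0)}).Adj (P.f x s) (P.f y t) := by
    intro x y s t hs ht h h₁ h₂
    rw [deleteEdges_adj]
    refine ⟨h, fun e => ?_⟩
    rcases Sym2.eq_iff.1 (Set.mem_singleton_iff.1 e) with ⟨e, e'⟩ | ⟨e, e'⟩
    · have := P.inj _ _ _ _ hs (Nat.zero_le _) e
      have := P.inj _ _ _ _ ht (Nat.zero_le _) e'
      tauto
    · have := P.inj _ _ _ _ hs (Nat.zero_le _) e
      have := P.inj _ _ _ _ ht (Nat.zero_le _) e'
      tauto
  have hconn : ∀ x s t, s ≤ t → t ≤ P.m x →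
      ((G.deleteEdges {s(P.f i 0, P.f j 0)}).induce (seg (P.f x) s t)).Connected := by
    intro x s t hst ht
    refine seg_connected hst fun r _ hr => hadj x x r (r + 1) (by omega) (by omega) ?_ ?_ ?_
    · exact (P.adj_same x r (r + 1) (by omega) (by omega)).2 (Or.inl rfl)
    · omega
    · omega
  have hdisj : ∀ x y s t s' t', t ≤ P.m x → t' ≤ P.m y → (x = y → t < s') →
      Disjoint (seg (P.f x) s t) (seg (P.f y) s' t') := by
    intro x y s t s' t' ht ht' h
    rw [Set.disjoint_left]
    rintro _ ⟨r, hr, rfl⟩ ⟨r', hr', e⟩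
    have := hr.1; have := hr.2; have := hr'.1; have := hr'.2
    obtain ⟨rfl, rfl⟩ := P.inj _ _ _ _ (by omega) (by omega) e
    have := h rfl
    omega
  have top : ∀ x y, x ≠ y → G.Adj (P.f x 0) (P.f y 0) := fun x y hxy =>
    (P.adj_cross x y 0 0 hxy (Nat.zero_le _) (Nat.zero_le _)).2 (Or.inl ⟨rfl, rfl⟩)
  have bot : ∀ x y, x ≠ y → G.Adj (P.f x (P.m x)) (P.f y (P.m y)) := fun x y hxy =>
    (P.adj_cross x y _ _ hxy le_rfl le_rfl).2 (Or.inr ⟨rfl, rfl⟩)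
  have touch : ∀ x y s s' t t', s' ≤ P.m x → t' ≤ P.m y → ∀ u v, s ≤ u → u ≤ s' → t ≤ v → v ≤ t' →
      G.Adj (P.f x u) (P.f y v) →
      ¬ (x = i ∧ y = j ∧ u = 0 ∧ v = 0) → ¬ (x = j ∧ y = i ∧ u = 0 ∧ v = 0) →
      (G.deleteEdges {s(P.f i 0, P.f j 0)}).Touch (seg (P.f x) s s') (seg (P.f y) t t') :=
    fun x y s s' t t' hs' ht' u v h₁ h₂ h₃ h₄ h h₅ h₆ =>
      ⟨_, apply_mem_seg h₁ h₂, _, apply_mem_seg h₃ h₄,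
        hadj x y u v (by omega) (by omega) h h₅ h₆⟩
  refine HasK4Minor.of_sets (A := seg (P.f k) 0 0) (B := seg (P.f i) 0 (P.m i))
    (C := seg (P.f j) 0 (P.m j)) (D := seg (P.f k) 1 (P.m k)) (hsub _ _ _ (by omega))
    (hsub _ _ _ (by omega)) (hsub _ _ _ (by omega)) (hsub _ _ _ (by omega))
    (hconn _ _ _ (by omega) (by omega)) (hconn _ _ _ (by omega) (by omega))
    (hconn _ _ _ (by omega) (by omega)) (hconn _ _ _ (by omega) (by omega))
    ?_ ?_ ?_ ?_ ?_ ?_ ?_ ?_ ?_ ?_ ?_ ?_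
  iterate 6 exact hdisj _ _ _ _ _ _ (by omega) (by omega) (by omega)
  · exact touch k i _ _ _ _ (by omega) (by omega) 0 0 (by omega) (by omega) (by omega) (by omega)
      (top k i hik.symm) (by omega) (by omega)
  · exact touch k j _ _ _ _ (by omega) (by omega) 0 0 (by omega) (by omega) (by omega) (by omega)
      (top k j hjk.symm) (by omega) (by omega)
  · exact touch k k _ _ _ _ (by omega) (by omega) 0 1 (by omega) (by omega) (by omega) (by omega)
      ((P.adj_same k 0 1 (by omega) (by omega)).2 (Or.inl rfl)) (by omega) (by omega)
  · exact touch i j _ _ _ _ (by omega) (by omega) _ _ (Nat.zero_le _) le_rfl (Nat.zero_le _) le_rfl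
      (bot i j hij) (by omega) (by omega)
  · exact touch i k _ _ _ _ (by omega) (by omega) _ _ (Nat.zero_le _) le_rfl (by omega) le_rfl
      (bot i k hik) (by omega) (by omega)
  · exact touch j k _ _ _ _ (by omega) (by omega) _ _ (Nat.zero_le _) le_rfl (by omega) le_rfl
      (bot j k hjk) (by omega) (by omega)

end PrismOn

namespace K33On

variable {X : Set V} (K : K33On G X)

theorem mem_l (i : Fin 3) : K.l i ∈ X := (K.mem_iff _).2 (Or.inl ⟨i, rfl⟩)

theorem mem_r (i : Fin 3) : K.r i ∈ X := (K.mem_iff _).2 (Or.inr ⟨i, rfl⟩)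

/-- Exchange the two sides. -/
def swap : K33On G X where
  l := K.r
  r := K.l
  l_inj := K.r_inj
  r_inj := K.l_inj
  ne i j := (K.ne j i).symm
  adj i j := (K.adj j i).symm
  not_adj_l := K.not_adj_r
  not_adj_r := K.not_adj_l
  mem_iff v := (K.mem_iff v).trans Or.comm

theorem nbrs_l (i : Fin 3) : (G.nbrs X (K.l i)).ncard = 3 := by
  have : G.nbrs X (K.l i) = Set.range K.r := by
    ext v
    constructor
    · rintro ⟨hv, h⟩
      rcases (K.mem_iff v).1 hv with ⟨j, rfl⟩ | ⟨j, rfl⟩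
      · exact absurd h (K.not_adj_l i j)
      · exact ⟨j, rfl⟩
    · rintro ⟨j, rfl⟩
      exact ⟨K.mem_r j, K.adj i j⟩
  rw [this, ← Nat.card_coe_set_eq, Nat.card_range_of_injective K.r_inj]
  simp

theorem nbrs_eq (K : K33On G X) {v : V} (hv : v ∈ X) : (G.nbrs X v).ncard = 3 := by
  rcases (K.mem_iff v).1 hv with ⟨i, rfl⟩ | ⟨i, rfl⟩
  · exact K.nbrs_l i
  · exact K.swap.nbrs_l i

theorem ncard_branchSet (K : K33On G X) : (G.branchSet X).ncard = 6 := by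
  have : G.branchSet X = Set.range (Sum.elim K.l K.r) := by
    ext v
    rw [Set.Sum.elim_range]
    exact ⟨fun h => (K.mem_iff v).1 h.1, fun h =>
      ⟨(K.mem_iff v).2 h, (K.nbrs_eq ((K.mem_iff v).2 h)).ge⟩⟩
  rw [this, ← Nat.card_coe_set_eq, Nat.card_range_of_injective (K.l_inj.sumElim K.r_inj K.ne)]
  simp

/-- Two disjoint edges are contracted, one at each end of the deleted edge; the two remaining
vertices are bags by themselves. -/
theorem hasK4Minor_deleteEdges (i j : Fin 3) :
    (G.deleteEdges {s(K.l i, K.r j)}).HasK4Minor X := by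
  have third : ∀ i : Fin 3, ∃ j k, i ≠ j ∧ i ≠ k ∧ j ≠ k := by decide
  obtain ⟨i', i'', h₁, h₂, h₃⟩ := third i
  obtain ⟨j', j'', h₄, h₅, h₆⟩ := third j
  have hadj : ∀ x y, ¬ (x = i ∧ y = j) →
      (G.deleteEdges {s(K.l i, K.r j)}).Adj (K.l x) (K.r y) := by
    intro x y h
    rw [deleteEdges_adj]
    refine ⟨K.adj x y, fun e => ?_⟩
    rcases Sym2.eq_iff.1 (Set.mem_singleton_iff.1 e) with ⟨e, e'⟩ | ⟨e, e'⟩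
    · exact h ⟨K.l_inj e, K.r_inj e'⟩
    · exact K.ne _ _ e
  have a₁ := hadj i'' j (by tauto)
  have a₂ := hadj i j'' (by tauto)
  have hl := K.l_inj
  have hr := K.r_inj
  have hlr := K.ne
  have hrl : ∀ x y, K.r x ≠ K.l y := fun x y => (K.ne y x).symm
  refine HasK4Minor.of_sets (A := {K.l i'}) (B := {K.r j'}) (C := {K.l i'', K.r j})
    (D := {K.l i, K.r j''}) ?_ ?_ ?_ ?_ (connected_induce_singleton _ _)
    (connected_induce_singleton _ _) (induce_pair_connected_of_adj a₁)
    (induce_pair_connected_of_adj a₂) ?_ ?_ ?_ ?_ ?_ ?_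
    ⟨_, rfl, _, rfl, hadj i' j' (by tauto)⟩
    ⟨_, rfl, _, Or.inr rfl, hadj i' j (by tauto)⟩
    ⟨_, rfl, _, Or.inr rfl, hadj i' j'' (by tauto)⟩
    ⟨_, rfl, _, Or.inl rfl, (hadj i'' j' (by tauto)).symm⟩
    ⟨_, rfl, _, Or.inl rfl, (hadj i j' (by tauto)).symm⟩
    ⟨_, Or.inl rfl, _, Or.inr rfl, hadj i'' j'' (by tauto)⟩
  · simp [K.mem_l]
  · simp [K.mem_r]
  · simp [Set.insert_subset_iff, K.mem_l, K.mem_r]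
  · simp [Set.insert_subset_iff, K.mem_l, K.mem_r]
  all_goals
    simp [hlr, hrl, hl.eq_iff, hr.eq_iff, h₂, h₃, h₆, h₁.symm, h₄.symm, h₅.symm]

end K33On

/-- Deleting an edge at a vertex of degree three destroys both shapes. -/
theorem not_shape_deleteEdges [Finite V] {X : Set V}
    (h : Nonempty (PrismOn G X) ∨ Nonempty (K33On G X)) {x y : V} (hx : x ∈ G.branchSet X)
    (hy : y ∈ X) (hxy : G.Adj x y)
    (h' : Nonempty (PrismOn (G.deleteEdges {s(x, y)}) X) ∨
      Nonempty (K33On (G.deleteEdges {s(x, y)}) X)) : False := by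
  have h₁ : (G.branchSet X).ncard = 6 ∧ ∀ v ∈ X, (G.nbrs X v).ncard ≤ 3 := by
    rcases h with ⟨⟨P⟩⟩ | ⟨⟨K⟩⟩
    · exact ⟨P.ncard_branchSet, fun v hv => P.nbrs_le hv⟩
    · exact ⟨K.ncard_branchSet, fun v hv => (K.nbrs_eq hv).le⟩
  have h₂ : ((G.deleteEdges {s(x, y)}).branchSet X).ncard = 6 := by
    rcases h' with ⟨⟨P⟩⟩ | ⟨⟨K⟩⟩
    · exact P.ncard_branchSet
    · exact K.ncard_branchSet
  have hsub : ∀ v, (G.deleteEdges {s(x, y)}).nbrs X v ⊆ G.nbrs X v := fun v u hu =>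
    ⟨hu.1, (deleteEdges_adj.1 hu.2).1⟩
  -- The vertex `x` had degree exactly three and drops to two, so it leaves the branch set, and no
  -- vertex enters.
  have hss : (G.deleteEdges {s(x, y)}).branchSet X ⊂ G.branchSet X := by
    refine ⟨fun v hv => ⟨hv.1, hv.2.trans (Set.ncard_le_ncard (hsub v) (Set.toFinite _))⟩,
      fun hle => ?_⟩
    have := (hle hx).2
    have hlt : ((G.deleteEdges {s(x, y)}).nbrs X x).ncard < (G.nbrs X x).ncard := by
      refine Set.ncard_lt_ncard ⟨hsub x, fun hle => ?_⟩ (Set.toFinite _)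
      have := (hle (⟨hy, hxy⟩ : y ∈ G.nbrs X x)).2
      rw [deleteEdges_adj] at this
      exact this.2 rfl
    have := h₁.2 x hx.1
    omega
  have := Set.ncard_lt_ncard hss (Set.toFinite _)
  omega

end SimpleGraph

/-! ### Back to trigraphs: strong adjacency and the final shapes. -/

namespace Trigraph

variable {V : Type*} {G : Trigraph V}

theorem adj_iff {u v : V} : G.Adj u v ↔ G.StrongAdj u v ∨ G.SemiAdj u v := by
  unfold Adj StrongAdj SemiAdj
  cases G.θ u v <;> decide

theorem isRealization_fullRealization : G.IsRealization G.fullRealization := by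
  intro u v
  refine ⟨fun h => adj_iff.2 (Or.inl h), fun h h' => ?_⟩
  have h'' : (0 : SignType) ≤ G.θ u v := h'
  rw [h.2] at h''
  exact absurd h'' (by decide)

theorem isRealization_deleteEdges {x y : V} (h : G.SemiAdj x y) :
    G.IsRealization (G.fullRealization.deleteEdges {s(x, y)}) := by
  intro u v
  refine ⟨fun huv => ?_, fun huv h' => ?_⟩
  · rw [SimpleGraph.deleteEdges_adj]
    refine ⟨(isRealization_fullRealization u v).1 huv, fun e => ?_⟩
    have h0 : G.θ x y = 0 := h
    have h1 : G.θ u v = 1 := huv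
    rcases Sym2.eq_iff.1 (Set.mem_singleton_iff.1 e) with ⟨rfl, rfl⟩ | ⟨rfl, rfl⟩
    · rw [h0] at h1
      exact absurd h1 (by decide)
    · rw [G.symm, h0] at h1
      exact absurd h1 (by decide)
  · exact (isRealization_fullRealization u v).2 huv (SimpleGraph.deleteEdges_adj.1 h').1

/-- If the pair were semi-adjacent, the graph without this edge would be a realization in which `X`
is still minimal. The classification then applies before and after the deletion, which is
impossible. -/
theorem strongAdj_of_hasK4Minor_deleteEdges [Finite V] (hI : G.IsISK4Free) (hW : G.IsWheelFree)
    {X : Set V} (hX : Minimal G.fullRealization.HasK4Minor X) {x y : V}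
    (hx : x ∈ G.fullRealization.branchSet X) (hy : y ∈ X) (hxy : G.Adj x y)
    (h : (G.fullRealization.deleteEdges {s(x, y)}).HasK4Minor X) : G.StrongAdj x y := by
  rcases adj_iff.1 hxy with hs | hs
  · exact hs
  exfalso
  have hr := isRealization_deleteEdges hs
  have hr' := isRealization_fullRealization (G := G)
  refine SimpleGraph.not_shape_deleteEdges
    (SimpleGraph.prismOn_or_k33On hX (hI _ hr') (hW _ hr')) hx hy hxy
    (SimpleGraph.prismOn_or_k33On ⟨h, fun Y hY hYX => ?_⟩ (hI _ hr) (hW _ hr))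
  exact hX.2 (hY.mono_graph (SimpleGraph.deleteEdges_le _)) hYX

theorem degree_induce {X : Set V} (v : X) :
    (G.induce X).degree v = (G.fullRealization.nbrs X v).ncard := by
  unfold degree
  rw [← Set.ncard_image_of_injective _ Subtype.val_injective]
  congr 1
  ext u
  constructor
  · rintro ⟨u, hu, rfl⟩
    exact ⟨u.2, hu⟩
  · rintro ⟨hu, h⟩
    exact ⟨⟨u, hu⟩, h, rfl⟩

theorem isPrism_induce {X : Set V} (P : G.fullRealization.PrismOn X)
    (hx : ∀ i j, i ≠ j → G.StrongAdj (P.f i 0) (P.f j 0))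
    (hy : ∀ i j, i ≠ j → G.StrongAdj (P.f i (P.m i)) (P.f j (P.m j))) :
    (G.induce X).IsPrism := by
  refine ⟨fun i => ⟨P.f i 0, P.mem (Nat.zero_le _)⟩, fun i => ⟨P.f i (P.m i), P.mem le_rfl⟩,
    fun i => {v | ∃ s ≤ P.m i, P.f i s = v}, fun i j hij => hx i j hij, fun i j hij => hy i j hij,
    ?_, ?_, ?_, ?_, ?_⟩
  · intro i j e
    have := P.inj i j _ _ (Nat.zero_le _) le_rfl (congrArg Subtype.val e)
    have := P.m_pos j
    omega
  · intro i
    have mi := P.m_pos i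
    refine ⟨⟨?_, ?_, ?_, ?_, ?_⟩, ?_⟩
    · obtain ⟨w, hw⟩ := SimpleGraph.exists_walk_follows (G := G.fullRealization) (X := X)
        (P.f i) (P.m i) (fun s hs => P.mem hs)
        (fun s hs => (P.adj_same i s (s + 1) hs.le hs).2 (Or.inl rfl))
        ⟨P.f i 0, P.mem (Nat.zero_le _)⟩ ⟨P.f i (P.m i), P.mem le_rfl⟩ rfl rfl
      refine ⟨w, hw.isPath fun s t hs ht e => (P.inj i i s t hs ht e).2, ?_, ?_⟩
      · refine SimpleGraph.Walk.isChordless_iff_forall_mem_edges.2 fun u v hu hv huv => ?_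
        refine hw.mem_edges_of_adj (fun s t hst ht h => ?_) hu hv huv
        rw [P.adj_same i s t (by omega) ht] at h
        omega
      · ext v
        exact hw.mem_support
    · intro e
      have := P.inj i i _ _ (Nat.zero_le _) le_rfl (congrArg Subtype.val e)
      omega
    · unfold IsBranchVertex
      rw [degree_induce]
      exact (P.nbrs_zero i).ge
    · unfold IsBranchVertex
      rw [degree_induce]
      exact (P.nbrs_last i).ge
    · rintro ⟨v, hv⟩ ⟨s, hs, rfl⟩ h0 hm hb
      unfold IsBranchVertex at hb
      rw [degree_induce] at hb
      have h0' : s ≠ 0 := by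
        rintro rfl
        exact h0 rfl
      have hm' : s ≠ P.m i := by
        rintro rfl
        exact hm rfl
      have := P.nbrs_interior i (s := s) (by omega) (by omega)
      exact absurd (hb.trans this) (by omega)
    · rintro ⟨u, hu⟩ ⟨s, hs, rfl⟩ ⟨v, hv⟩ ⟨t, ht, rfl⟩ huv ⟨w, hw⟩ ⟨huw, hvw⟩
      obtain ⟨k, r, hr, rfl⟩ := (P.mem_iff w).1 hw
      have huv := (P.adj_same i s t hs ht).1 huv
      have mk := P.m_pos k
      by_cases hk : i = k
      · subst hk
        have := (P.adj_same i s r hs hr).1 huw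
        have := (P.adj_same i t r ht hr).1 hvw
        omega
      -- Two consecutive vertices with a common neighbor on another rung would be the two ends of a
      -- rung of length one. That neighbor would then be both ends of its own rung, contrary to
      -- `mk`.
      · have := (P.adj_cross i k s r hk hs hr).1 huw
        have := (P.adj_cross i k t r hk ht hr).1 hvw
        omega
  · intro i j hij
    rw [Set.disjoint_left]
    rintro v ⟨s, hs, e⟩ ⟨t, ht, e'⟩
    exact hij (P.inj i j s t hs ht (e.trans e'.symm)).1
  · rintro i j hij ⟨u, hu⟩ ⟨s, hs, rfl⟩ ⟨v, hv⟩ ⟨t, ht, rfl⟩ huv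
    rcases (P.adj_cross i j s t hij hs ht).1 huv with ⟨rfl, rfl⟩ | ⟨rfl, rfl⟩
    · exact Or.inl ⟨rfl, rfl⟩
    · exact Or.inr ⟨rfl, rfl⟩
  · rintro ⟨v, hv⟩
    obtain ⟨i, s, hs, e⟩ := (P.mem_iff v).1 hv
    exact ⟨i, s, hs, e⟩

theorem isStrongK33_induce {X : Set V} (K : G.fullRealization.K33On X)
    (h : ∀ i j, G.StrongAdj (K.l i) (K.r j)) : (G.induce X).IsStrongK33 := by
  constructor
  · let e : Fin 3 ⊕ Fin 3 → X :=
      Sum.elim (fun i => ⟨K.l i, K.mem_l i⟩) fun i => ⟨K.r i, K.mem_r i⟩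
    have he : Function.Bijective e := by
      constructor
      · rintro (i | i) (j | j) hij
        · rw [K.l_inj (congrArg Subtype.val hij)]
        · exact absurd (congrArg Subtype.val hij) (K.ne i j)
        · exact absurd (congrArg Subtype.val hij).symm (K.ne j i)
        · rw [K.r_inj (congrArg Subtype.val hij)]
      · rintro ⟨v, hv⟩
        rcases (K.mem_iff v).1 hv with ⟨i, rfl⟩ | ⟨i, rfl⟩
        · exact ⟨Sum.inl i, rfl⟩
        · exact ⟨Sum.inr i, rfl⟩
    refine ⟨SimpleGraph.Iso.symm ⟨Equiv.ofBijective e he, ?_⟩⟩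
    rintro (i | i) (j | j)
    · exact iff_of_false (K.not_adj_l i j) (by simp)
    · exact iff_of_true (K.adj i j) (by simp)
    · exact iff_of_true (K.adj j i).symm (by simp)
    · exact iff_of_false (K.not_adj_r i j) (by simp)
  · rintro ⟨u, hu⟩ ⟨v, hv⟩ huv
    have hadj : G.fullRealization.Adj u v := adj_iff.2 (Or.inr huv)
    have h0 : G.θ u v = 0 := huv
    rcases (K.mem_iff u).1 hu with ⟨i, rfl⟩ | ⟨i, rfl⟩ <;>
      rcases (K.mem_iff v).1 hv with ⟨j, rfl⟩ | ⟨j, rfl⟩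
    · exact K.not_adj_l i j hadj
    · have h1 : G.θ (K.l i) (K.r j) = 1 := h i j
      rw [h0] at h1
      exact absurd h1 (by decide)
    · have h1 : G.θ (K.l j) (K.r i) = 1 := h j i
      rw [G.symm, h0] at h1
      exact absurd h1 (by decide)
    · exact K.not_adj_r i j hadj

end Trigraph

theorem mainTheorem5 {V : Type*} [Finite V] (G : Trigraph V)
    (hISK4 : G.IsISK4Free) (hwheel : G.IsWheelFree) :
    G.IsSeriesParallel ∨ (∃ X : Set V, (G.induce X).IsPrism) ∨
      ∃ X : Set V, (G.induce X).IsStrongK33 := by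
  rw [or_iff_not_imp_left]
  intro hsp
  obtain ⟨S, hS⟩ : ∃ S : G.fullRealization.Subgraph,
      S.coe.IsSubdivisionOf (SimpleGraph.completeGraph (Fin 4)) := by
    simpa [Trigraph.IsSeriesParallel, SimpleGraph.IsSeriesParallel] using hsp
  obtain ⟨X, -, hX⟩ := exists_minimal_le_of_wellFoundedLT G.fullRealization.HasK4Minor Set.univ
    (SimpleGraph.Subgraph.hasK4Minor_of_isSubdivisionOf hS)
  have hr := Trigraph.isRealization_fullRealization (G := G)
  rcases SimpleGraph.prismOn_or_k33On hX (hISK4 _ hr) (hwheel _ hr) with ⟨⟨P⟩⟩ | ⟨⟨K⟩⟩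
  · have key : ∀ (P : G.fullRealization.PrismOn X) (i j : Fin 3), i ≠ j →
        G.StrongAdj (P.f i 0) (P.f j 0) := fun P i j hij =>
      Trigraph.strongAdj_of_hasK4Minor_deleteEdges hISK4 hwheel hX
        ⟨P.mem (Nat.zero_le _), (P.nbrs_zero i).ge⟩ (P.mem (Nat.zero_le _))
        ((P.adj_cross i j 0 0 hij (Nat.zero_le _) (Nat.zero_le _)).2 (Or.inl ⟨rfl, rfl⟩))
        (P.hasK4Minor_deleteEdges hij)
    -- Exchanging the triangles lets `key` cover the second one too.
    exact Or.inl ⟨X, Trigraph.isPrism_induce P (key P) (key P.flip)⟩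
  · exact Or.inr ⟨X, Trigraph.isStrongK33_induce K fun i j =>
      Trigraph.strongAdj_of_hasK4Minor_deleteEdges hISK4 hwheel hX
        ⟨K.mem_l i, (K.nbrs_l i).ge⟩ (K.mem_r j) (K.adj i j) (K.hasK4Minor_deleteEdges i j)⟩
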